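/- **Setting.** Let $n\ge 0$, let $(e_i)_{1\le i\le n}$ be the standard basis of $\mathbb C^n$ with $(e_i,e_j)=\delta_{ij}$, and let $\alpha_i=e_i-e_{i+1}$, $\Gamma=\{\alpha_1,\dots,\alpha_{n-1}\}$. A Belavin–Drinfeld triple $(\Gamma_1,\Gamma_2,\tau)$ consists of subsets $\Gamma_1,\Gamma_2\subset\Gamma$ and a bijection $\tau:\Gamma_1\to\Gamma_2$ preserving $(\,,)$ and such that for every $\alpha\in\Gamma_1$ some $\tau^k\alpha\notin\Gamma_1$. Positive roots are the $e_i-e_j$, $i<j$. For $\alpha=e_i-e_j$ put $e_\alpha=e_{ij}$ (matrix unit) and $|\alpha|=|j-i|$. Extend $\tau$ additively to the positive roots in the span of $\Gamma_1$, and write $\alpha\prec\beta$ if $\tau^k\alpha=\beta$ for some $k\ge1$. For $\alpha=e_i-e_j$ with $|\alpha|>1$ and $\tau^k\alpha=\beta=e_p-e_l$, $k\ge 1$, write $\alpha\prec^{\leftarrow}\beta$ if $\tau^k\alpha_i=\alpha_{l-1}$; then $\mathrm{sign}(\alpha,\beta)=(-1)^{1-|\alpha|}$, and $\mathrm{sign}(\alpha,\beta)=1$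 for all other $\alpha\prec\beta$. For positive roots write $e_i-e_j\lessdot e_k-e_l$ iff $j=k$, and $\alpha\gtrdot\beta$ iff $\beta\lessdot\alpha$. $[S]$ is $1$ if $S$ is true and $0$ otherwise. Let $r^0=\sum_{i,j} s_{ij}\,e_{ii}\otimes e_{jj}$ with $s_{ij}=-s_{ji}\in\mathbb C$ satisfy $[(\alpha-\tau\alpha)\otimes1]r^0=\tfrac12[(\alpha+\tau\alpha)\otimes1]\sum_i e_{ii}\otimes e_{ii}$ for all $\alpha\in\Gamma_1$ (where $\sum_i\lambda_ie_i$ acts on diagonal matrices by $\sum_i a_ie_{ii}\mapsto\sum_i\lambda_ia_i$). Put, with $x\wedge y=x\otimes y-y\otimes x$, $$a=\sum_{\alpha\prec\beta}\mathrm{sign}(\alpha,\beta)\,e_{-\alpha}\wedge e_\beta,\quad r_s=\tfrac12\sum_ie_{ii}\otimes e_{ii}+\sum_{\alpha>0}e_{-\alpha}\otimes e_\alpha,\quad r=r^0+a+r_s,\quad \epsilon=ar_s+r_sa+a^2.$$ For $\hbar\in\mathbb C$ let $q=e^\hbar$, $q^y=e^{\hbar y}$, and $$R_s=q\sum_ie_{ii}\otimes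 e_{ii}+\sum_{i\ne j}e_{ii}\otimes e_{jj}+(q-q^{-1})\sum_{i>j}e_{ij}\otimes e_{ji}.$$ Writing $z=\sum z_{ik}^{jl}e_{ij}\otimes e_{kl}$, put $\tilde a=\sum a_{ik}^{jl}q^{a_{ik}^{jl}\epsilon_{ik}^{jl}}e_{ij}\otimes e_{kl}$ and $$R_{\mathrm{GGS}}=q^{r^0}\bigl(R_s+(q-q^{-1})\tilde a\bigr)q^{r^0}.$$ Finally put $$K_{\alpha,\beta}=\tfrac12[\alpha\lessdot\beta,\alpha\prec\beta]-\tfrac12[\alpha\gtrdot\beta,\alpha\prec\beta]+[\exists\gamma:\alpha\prec\gamma\prec\beta,\alpha\lessdot\gamma]-[\exists\gamma:\alpha\prec\gamma\prec\beta,\alpha\gtrdot\gamma]+[\alpha\prec^{\leftarrow}\beta](1-|\alpha|),$$ $$J^m=1+(q-q^{-1})\sum_{\tau^m\alpha=\beta}\mathrm{sign}(\alpha,\beta)\,q^{K_{\alpha,\beta}}e_\beta\otimes e_{-\alpha},\qquad J=J^1J^2J^3\cdots$$ (a finite product, since $J^m=1$ for large $m$), and $R_J=q^{r^0}J^{-1}R_sJ_{21}q^{r^0}$,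 where $J_{21}$ is $J$ with its tensor factors interchanged. **Theorem.** Let $(\Gamma_1,\Gamma_2,\tau)$ be the Cremmer–Gervais triple $\Gamma_1=\{\alpha_1,\dots,\alpha_{n-2}\}$, $\Gamma_2=\{\alpha_2,\dots,\alpha_{n-1}\}$, $\tau\alpha_i=\alpha_{i+1}$, or its inverse $(\Gamma_2,\Gamma_1,\tau^{-1})$, and let $r^0$ be any element as above. Then: 1. $R_{\mathrm{GGS}}$, as a function of $\hbar$, is the unique matrix all of whose entries have the form $x\,q^y(q-q^{-1})^z$ with $x,y\in\mathbb C$, $z\in\{0,1\}$, and which satisfies $R_{\mathrm{GGS}}\equiv1+2\hbar r+2\hbar^2r^2\pmod{\hbar^3}$; 2. $R_J=R_{\mathrm{GGS}}$ for every $\hbar\in\mathbb C$; 3. $R_J$ satisfies the quantum Yang–Baxter equation $R_{12}R_{13}R_{23}=R_{23}R_{13}R_{12}$ for every $\hbar\in\mathbb C$. -/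

import Mathlib

open scoped Kronecker
open Matrix Asymptotics

noncomputable section

namespace GGS

/-- `Mat_n(ℂ) ⊗ Mat_n(ℂ)`: the coefficient of `e_{ij} ⊗ e_{kl}` is the entry at row `(i, k)` and
column `(j, l)`. -/
abbrev Mat2 (n : ℕ) := Matrix (Fin n × Fin n) (Fin n × Fin n) ℂ

/-- The vector `e_i - e_j` of `ℂⁿ`, for the pair `p = (i, j)`. -/
def rootVec {n : ℕ} (p : Fin n × Fin n) : Fin n → ℂ :=
  Pi.single p.1 1 - Pi.single p.2 1

/-- The pair `(k, k + 1)`, standing for the simple root `α_k = e_k - e_{k+1}` (indices from `0`). -/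
def simplePair {n : ℕ} (k : Fin (n - 1)) : Fin n × Fin n :=
  (⟨k.val, by omega⟩, ⟨k.val + 1, by omega⟩)

/-- The simple root `α_k = e_k - e_{k+1}`. -/
def simpleRoot {n : ℕ} (k : Fin (n - 1)) : Fin n → ℂ := rootVec (simplePair k)

/-- A Belavin-Drinfeld triple of type `A_{n-1}`; the simple root `α_k` is represented by `k`. -/
structure BDTriple (n : ℕ) where
  Γ₁ : Finset (Fin (n - 1))
  Γ₂ : Finset (Fin (n - 1))
  τ : Γ₁ ≃ Γ₂
  isometry : ∀ a b : Γ₁,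
    simpleRoot (τ a).1 ⬝ᵥ simpleRoot (τ b).1 = simpleRoot a.1 ⬝ᵥ simpleRoot b.1
  /-- Iterating `τ` from any element of `Γ₁` eventually leads out of `Γ₁`. -/
  nilpotent : ∀ a ∈ Γ₁, ∃ b, b ∉ Γ₁ ∧
    Relation.TransGen (fun x y => ∃ h : x ∈ Γ₁, (τ ⟨x, h⟩).1 = y) a b

namespace BDTriple

variable {n : ℕ}

theorem nilpotent_inverse (T : BDTriple n) : ∀ a ∈ T.Γ₂, ∃ b, b ∉ T.Γ₂ ∧
    Relation.TransGen (fun x y => ∃ h : x ∈ T.Γ₂, (T.τ.symm ⟨x, h⟩).1 = y) a b := by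
  set r : Fin (n - 1) → Fin (n - 1) → Prop :=
    fun x y => ∃ h : x ∈ T.Γ₁, (T.τ ⟨x, h⟩).1 = y with hr
  have hfun : ∀ x y, Relation.TransGen r x x → r x y → Relation.TransGen r y y := by
    intro x y hx hxy
    obtain ⟨z, hz, hzx⟩ := Relation.TransGen.head'_iff.1 hx
    have : z = y := by
      obtain ⟨h1, e1⟩ := hz
      obtain ⟨h2, e2⟩ := hxy
      rw [← e1, ← e2]
    subst this
    exact Relation.TransGen.tail' hzx hxy
  have hchain : ∀ x y, Relation.TransGen r x y → Relation.TransGen r x x →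
      Relation.TransGen r y y := by
    intro x y hxy hx
    induction hxy with
    | single h => exact hfun _ _ hx h
    | tail _ h ih => exact hfun _ _ ih h
  have hmem : ∀ x, Relation.TransGen r x x → x ∈ T.Γ₁ := by
    intro x hx
    obtain ⟨z, ⟨h, _⟩, _⟩ := Relation.TransGen.head'_iff.1 hx
    exact h
  have hirr : ∀ x, ¬ Relation.TransGen r x x := by
    intro x hx
    obtain ⟨b, hb, hxb⟩ := T.nilpotent x (hmem x hx)
    exact hb (hmem b (hchain x b hxb hx))
  have : Std.Irrefl (Relation.TransGen r) := ⟨hirr⟩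
  have hwf : WellFounded (Relation.TransGen r) :=
    Finite.wellFounded_of_trans_of_irrefl _
  intro a
  induction a using hwf.induction with
  | _ a ih =>
    intro ha
    have hstep : r (T.τ.symm ⟨a, ha⟩).1 a := ⟨(T.τ.symm ⟨a, ha⟩).2, by simp⟩
    by_cases hc : (T.τ.symm ⟨a, ha⟩).1 ∈ T.Γ₂
    · obtain ⟨b, hb, hab⟩ := ih _ (Relation.TransGen.single hstep) hc
      exact ⟨b, hb, Relation.TransGen.head ⟨ha, rfl⟩ hab⟩
    · exact ⟨_, hc, Relation.TransGen.single ⟨ha, rfl⟩⟩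

/-- The triple `(Γ₂, Γ₁, τ⁻¹)`. -/
def inverse (T : BDTriple n) : BDTriple n where
  Γ₁ := T.Γ₂
  Γ₂ := T.Γ₁
  τ := T.τ.symm
  isometry a b := by
    have h := T.isometry (T.τ.symm a) (T.τ.symm b)
    simp only [Equiv.apply_symm_apply] at h
    exact h.symm
  nilpotent := T.nilpotent_inverse

/-- The Cremmer-Gervais triple. With roots numbered `α_1, …, α_{n-1}` (so that `α_{k+1}` is
represented by `k`): `Γ₁ = {α_1, …, α_{n-2}}`, `Γ₂ = {α_2, …, α_{n-1}}`, `τ α_i = α_{i+1}`. -/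
def cremmerGervais (n : ℕ) : BDTriple n where
  Γ₁ := Finset.univ.filter fun k => k.val + 1 < n - 1
  Γ₂ := Finset.univ.filter fun k => 0 < k.val
  τ :=
    { toFun := fun k => ⟨⟨k.1.val + 1, (Finset.mem_filter.1 k.2).2⟩, by simp⟩
      invFun := fun k => ⟨⟨k.1.val - 1, by omega⟩, by
        have := (Finset.mem_filter.1 k.2).2
        have := k.1.isLt
        simp only [Finset.mem_filter, Finset.mem_univ, true_and]
        omega⟩
      left_inv := fun k => by ext; simp
      right_inv := fun k => by
        have := (Finset.mem_filter.1 k.2).2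
        ext
        simp only
        omega }
  isometry a b := by
    simp only [simpleRoot, rootVec, simplePair, Equiv.coe_fn_mk, sub_dotProduct,
      single_dotProduct, Pi.sub_apply, Pi.single_apply, Fin.mk.injEq]
    simp
  nilpotent := by
    have key : ∀ (m : ℕ) (a : Fin (n - 1)), a.val + 1 < n - 1 → n - a.val = m →
        ∃ b, b ∉ (Finset.univ.filter fun k : Fin (n - 1) => k.val + 1 < n - 1) ∧
        Relation.TransGen (fun x y : Fin (n - 1) =>
          ∃ _ : x ∈ Finset.univ.filter fun k : Fin (n - 1) => k.val + 1 < n - 1,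
            x.val + 1 = y.val) a b := by
      intro m
      induction m with
      | zero => intro a ha h; omega
      | succ m ih =>
        intro a ha h
        by_cases hb : a.val + 1 + 1 < n - 1
        · obtain ⟨b, hb1, hb2⟩ := ih ⟨a.val + 1, ha⟩ hb (by simp only; omega)
          exact ⟨b, hb1, Relation.TransGen.head ⟨by simpa using ha, rfl⟩ hb2⟩
        · exact ⟨⟨a.val + 1, ha⟩, by simpa using hb,
            Relation.TransGen.single ⟨by simpa using ha, rfl⟩⟩
    intro a ha
    obtain ⟨b, hb, hab⟩ := key _ a (Finset.mem_filter.1 ha).2 rfl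
    exact ⟨b, hb, Relation.TransGen.mono (fun x y ⟨h, e⟩ => ⟨h, Fin.ext e⟩) _ _ hab⟩

end BDTriple

/-! Positive roots `e_i - e_j` are represented by pairs `(i, j)` with `i < j`. -/

/-- `|α|` -/
def rootLen {n : ℕ} (α : Fin n × Fin n) : ℤ := (α.2.val : ℤ) - α.1.val

/-- `e_α = e_{ij}` for `α = e_i - e_j`. -/
def eMat {n : ℕ} (α : Fin n × Fin n) : Matrix (Fin n) (Fin n) ℂ := Matrix.single α.1 α.2 1

/-- `e_i - e_j ⋖ e_k - e_l` iff `j = k`; `α ⋗ β` means `β ⋖ α`. -/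
def Lessdot {n : ℕ} (α β : Fin n × Fin n) : Prop := α.2 = β.1

open Classical in
/-- The bracket `[p]`, which is `1` if `p` is true and `0` otherwise. -/
def iverson (p : Prop) : ℂ := if p then 1 else 0

/-- `x ↦ x_{21}`, the flip of the two tensor factors. -/
def flip21 {n : ℕ} (x : Mat2 n) : Mat2 n := x.submatrix Prod.swap Prod.swap

/-- `x ∧ y = x ⊗ y - y ⊗ x` -/
def wedge {n : ℕ} (x y : Matrix (Fin n) (Fin n) ℂ) : Mat2 n := x ⊗ₖ y - y ⊗ₖ x

/-- `r_s = ½ ∑ e_{ii} ⊗ e_{ii} + ∑_{α > 0} e_{-α} ⊗ e_α` -/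
def rStd (n : ℕ) : Mat2 n :=
  (1 / 2 : ℂ) • (∑ i : Fin n, eMat (i, i) ⊗ₖ eMat (i, i)) +
    ∑ i : Fin n, ∑ j : Fin n, if i < j then eMat (j, i) ⊗ₖ eMat (i, j) else 0

/-- `q^y` for `q = e^ħ`. -/
def qpow (ħ y : ℂ) : ℂ := Complex.exp (ħ * y)

/-- `q - q⁻¹` for `q = e^ħ`. -/
def qdiff (ħ : ℂ) : ℂ := Complex.exp ħ - Complex.exp (-ħ)

/-- The standard Drinfeld-Jimbo matrix
`R_s = q ∑ e_{ii} ⊗ e_{ii} + ∑_{i ≠ j} e_{ii} ⊗ e_{jj} + (q - q⁻¹) ∑_{i > j} e_{ij} ⊗ e_{ji}`. -/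
def RStd (n : ℕ) (ħ : ℂ) : Mat2 n :=
  Complex.exp ħ • (∑ i : Fin n, eMat (i, i) ⊗ₖ eMat (i, i)) +
    (∑ i : Fin n, ∑ j : Fin n, if i ≠ j then eMat (i, i) ⊗ₖ eMat (j, j) else 0) +
    qdiff ħ • ∑ i : Fin n, ∑ j : Fin n, if j < i then eMat (i, j) ⊗ₖ eMat (j, i) else 0

/-- The element `r⁰ = ∑ s_{ij} e_{ii} ⊗ e_{jj}` of `𝔥 ⊗ 𝔥`. -/
def rZero {n : ℕ} (s : Matrix (Fin n) (Fin n) ℂ) : Mat2 n :=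
  Matrix.diagonal fun p => s p.1 p.2

/-- `q^{r⁰}`; since `r⁰` is diagonal this is the entrywise exponential of the diagonal. -/
def qpowRZero {n : ℕ} (s : Matrix (Fin n) (Fin n) ℂ) (ħ : ℂ) : Mat2 n :=
  Matrix.diagonal fun p => qpow ħ (s p.1 p.2)

/-- `R_{12}`, `R_{13}`, `R_{23}`: `R` acting on two of the three factors of `ℂⁿ ⊗ ℂⁿ ⊗ ℂⁿ`. -/
def R12 {n : ℕ} (R : Mat2 n) : Matrix (Fin n × Fin n × Fin n) (Fin n × Fin n × Fin n) ℂ :=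
  Matrix.of fun a b => if a.2.2 = b.2.2 then R (a.1, a.2.1) (b.1, b.2.1) else 0

/-- See `R12`. -/
def R13 {n : ℕ} (R : Mat2 n) : Matrix (Fin n × Fin n × Fin n) (Fin n × Fin n × Fin n) ℂ :=
  Matrix.of fun a b => if a.2.1 = b.2.1 then R (a.1, a.2.2) (b.1, b.2.2) else 0

/-- See `R12`. -/
def R23 {n : ℕ} (R : Mat2 n) : Matrix (Fin n × Fin n × Fin n) (Fin n × Fin n × Fin n) ℂ :=
  Matrix.of fun a b => if a.1 = b.1 then R (a.2.1, a.2.2) (b.2.1, b.2.2) else 0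

/-- The quantum Yang-Baxter equation. -/
def QYBE {n : ℕ} (R : Mat2 n) : Prop := R12 R * R13 R * R23 R = R23 R * R13 R * R12 R

namespace BDTriple

variable {n : ℕ} (T : BDTriple n)

/-- `r⁰ = ∑ s_{ij} e_{ii} ⊗ e_{jj}` lies in `𝔥 ∧ 𝔥` and satisfies
`[(α - τ α) ⊗ 1] r⁰ = ½ [(α + τ α) ⊗ 1] P⁰` for all `α ∈ Γ₁`, where `P⁰ = ∑ e_{ii} ⊗ e_{ii}`.
A functional `λ = ∑ λ_i e_i` gives `(λ ⊗ 1) r⁰ = ∑_j (∑_i λ_i s_{ij}) e_{jj}` and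
`(λ ⊗ 1) P⁰ = ∑_j λ_j e_{jj}`; the equation compares coefficients of `e_{jj}`. -/
def IsR0 (s : Matrix (Fin n) (Fin n) ℂ) : Prop :=
  sᵀ = -s ∧ ∀ k : T.Γ₁,
    (simpleRoot k.1 - simpleRoot (T.τ k).1) ᵥ* s =
      (1 / 2 : ℂ) • (simpleRoot k.1 + simpleRoot (T.τ k).1)

/-- `α ∈ Γ̃₁` and `τ α = β`, where `τ` is extended additively: all simple roots in
`α = e_i - e_j = ∑_{i ≤ k < j} α_k` lie in `Γ₁`, and `∑_{i ≤ k < j} τ α_k = β`. -/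
def Step (α β : Fin n × Fin n) : Prop :=
  α.1 < α.2 ∧ β.1 < β.2 ∧
    (∀ k : Fin (n - 1), α.1.val ≤ k.val → k.val < α.2.val → k ∈ T.Γ₁) ∧
    (∑ k : T.Γ₁, if α.1.val ≤ k.1.val ∧ k.1.val < α.2.val then simpleRoot (T.τ k).1 else 0) =
      rootVec β

/-- `τ^m α` is defined and equals `β`. -/
def Pow : ℕ → Fin n × Fin n → Fin n × Fin n → Prop
  | 0, α, β => α = β
  | m + 1, α, β => ∃ γ, T.Step α γ ∧ Pow m γ β

/-- `α ≺ β`: `τ^m α = β` for some `m ≥ 1`. -/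
def Prec (α β : Fin n × Fin n) : Prop := ∃ m, 1 ≤ m ∧ T.Pow m α β

/-- `α ≺^← β`: for `α = e_i - e_j` with `|α| > 1` and `β = e_k - e_l = τ^m α`, the power `τ^m`
maps the first simple root `α_i` of `α` to the last simple root `α_{l-1}` of `β`. -/
def PrecRev (α β : Fin n × Fin n) : Prop :=
  1 < rootLen α ∧ ∃ m, 1 ≤ m ∧ T.Pow m α β ∧
    ∃ a b : Fin (n - 1), a.val = α.1.val ∧ b.val + 1 = β.2.val ∧
      T.Pow m (simplePair a) (simplePair b)

open Classical in
/-- `sign(α, β)` -/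
def sign (α β : Fin n × Fin n) : ℂ :=
  if T.PrecRev α β then (-1) ^ (1 - rootLen α) else 1

/-- `a = ∑_{α ≺ β} sign(α, β) e_{-α} ∧ e_β` -/
def aMat : Mat2 n :=
  ∑ α : Fin n × Fin n, ∑ β : Fin n × Fin n,
    (iverson (T.Prec α β) * T.sign α β) • wedge (eMat α.swap) (eMat β)

/-- `r = r⁰ + a + r_s` -/
def rMat (s : Matrix (Fin n) (Fin n) ℂ) : Mat2 n := rZero s + T.aMat + rStd n

/-- `ε = a r_s + r_s a + a²` -/
def epsMat : Mat2 n := T.aMat * rStd n + rStd n * T.aMat + T.aMat * T.aMat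

/-- `ã`, whose entries are `a_{ik}^{jl} q^{a_{ik}^{jl} ε_{ik}^{jl}}`. -/
def aTilde (ħ : ℂ) : Mat2 n :=
  Matrix.of fun x y => T.aMat x y * qpow ħ (T.aMat x y * T.epsMat x y)

/-- `R_GGS = q^{r⁰} (R_s + (q - q⁻¹) ã) q^{r⁰}` -/
def RGGS (s : Matrix (Fin n) (Fin n) ℂ) (ħ : ℂ) : Mat2 n :=
  qpowRZero s ħ * (RStd n ħ + qdiff ħ • T.aTilde ħ) * qpowRZero s ħ

/-- The defining property of the GGS `R`-matrix, as a function of `ħ`: every entry has the form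
`x q^y (q - q⁻¹)^z` with `x, y ∈ ℂ` and `z ∈ {0, 1}`, and `R ≡ 1 + 2ħr + 2ħ²r² (mod ħ³)`. -/
def IsGGS (s : Matrix (Fin n) (Fin n) ℂ) (R : ℂ → Mat2 n) : Prop :=
  (∀ u v, ∃ x y : ℂ, ∃ z : ℕ, (z = 0 ∨ z = 1) ∧
    ∀ ħ, R ħ u v = x * qpow ħ y * qdiff ħ ^ z) ∧
  ∀ u v, (fun ħ : ℂ => R ħ u v -
      (1 + (2 * ħ) • T.rMat s + (2 * ħ ^ 2) • (T.rMat s * T.rMat s) : Mat2 n) u v)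
    =O[nhds 0] fun ħ => ħ ^ 3

/-- The half-integers
`K_{α,β} = ½[α ⋖ β, α ≺ β] - ½[α ⋗ β, α ≺ β] + [∃ γ, α ≺ γ ≺ β, α ⋖ γ]
  - [∃ γ, α ≺ γ ≺ β, α ⋗ γ] + [α ≺^← β] (1 - |α|)`. -/
def K (α β : Fin n × Fin n) : ℂ :=
  1 / 2 * iverson (Lessdot α β ∧ T.Prec α β) - 1 / 2 * iverson (Lessdot β α ∧ T.Prec α β) +
    iverson (∃ γ, T.Prec α γ ∧ T.Prec γ β ∧ Lessdot α γ) -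
    iverson (∃ γ, T.Prec α γ ∧ T.Prec γ β ∧ Lessdot γ α) +
    iverson (T.PrecRev α β) * (1 - (rootLen α : ℂ))

/-- `A^m = (q - q⁻¹) ∑_{β = τ^m α} sign(α, β) q^{K_{α,β}} e_β ⊗ e_{-α}` -/
def AMat (m : ℕ) (ħ : ℂ) : Mat2 n :=
  qdiff ħ • ∑ α : Fin n × Fin n, ∑ β : Fin n × Fin n,
    (iverson (T.Pow m α β) * T.sign α β * qpow ħ (T.K α β)) • (eMat β ⊗ₖ eMat α.swap)

/-- `J = J^1 J^2 ⋯` with `J^m = 1 + A^m`. The product stops at `m = n`: `τ^m` is nowhere defined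
for `m ≥ n - 1`, so all further factors are `1`. -/
def JMat (ħ : ℂ) : Mat2 n :=
  ((List.range n).map fun m => 1 + T.AMat (m + 1) ħ).prod

/-- `R_J = q^{r⁰} J⁻¹ R_s J_{21} q^{r⁰}` -/
def RJ (s : Matrix (Fin n) (Fin n) ℂ) (ħ : ℂ) : Mat2 n :=
  qpowRZero s ħ * ((T.JMat ħ)⁻¹ * RStd n ħ * flip21 (T.JMat ħ)) * qpowRZero s ħ

end BDTriple

end GGS

end

open scoped Kronecker
open Matrix Asymptotics

noncomputable section

namespace GGS

theorem iverson_true {p : Prop} (h : p) : iverson p = 1 := if_pos h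

theorem iverson_false {p : Prop} (h : ¬p) : iverson p = 0 := if_neg h

theorem eMat_apply {n : ℕ} (α : Fin n × Fin n) (i j : Fin n) :
    eMat α i j = if α = (i, j) then 1 else 0 := by
  obtain ⟨a, b⟩ := α
  simp [eMat, Matrix.single_apply]

theorem sum_smul_eMat_kronecker_apply {n : ℕ} (f : Fin n × Fin n → Fin n × Fin n → ℂ)
    (u v : Fin n × Fin n) :
    (∑ α, ∑ β, f α β • (eMat β ⊗ₖ eMat α.swap)) u v = f (v.2, u.2) (u.1, v.1) := by
  simp only [Matrix.sum_apply, Matrix.smul_apply, kroneckerMap_apply, eMat_apply, smul_eq_mul]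
  rw [Finset.sum_eq_single (v.2, u.2), Finset.sum_eq_single (u.1, v.1)]
  · simp
  · intro b _ hb
    simp [hb]
  · simp
  · intro b _ hb
    apply Finset.sum_eq_zero
    intro β _
    rw [if_neg (c := b.swap = _)]
    · simp
    · intro h
      apply hb
      rw [← b.swap_swap, h]
      rfl
  · simp

theorem sum_smul_eMat_kronecker_apply' {n : ℕ} (f : Fin n × Fin n → Fin n × Fin n → ℂ)
    (u v : Fin n × Fin n) :
    (∑ α, ∑ β, f α β • (eMat α.swap ⊗ₖ eMat β)) u v = f (v.1, u.1) (u.2, v.2) := by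
  refine Eq.trans ?_ (sum_smul_eMat_kronecker_apply f u.swap v.swap)
  simp only [Matrix.sum_apply, Matrix.smul_apply, kroneckerMap_apply, smul_eq_mul, Prod.fst_swap,
    Prod.snd_swap]
  refine Finset.sum_congr rfl fun _ _ => Finset.sum_congr rfl fun _ _ => ?_
  ring

/-- The flip `∑_{i > j} e_{ij} ⊗ e_{ji}`. -/
def lowFlip (n : ℕ) : Mat2 n := Matrix.of fun u v => if v = u.swap ∧ u.2 < u.1 then 1 else 0

theorem sum_eMat_kronecker_diag (n : ℕ) :
    (∑ i : Fin n, eMat (i, i) ⊗ₖ eMat (i, i)) =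
      Matrix.diagonal fun u : Fin n × Fin n => if u.1 = u.2 then (1 : ℂ) else 0 := by
  ext ⟨x, y⟩ ⟨x', y'⟩
  simp only [Matrix.sum_apply, kroneckerMap_apply, eMat_apply, Matrix.diagonal_apply,
    Prod.mk.injEq]
  rw [Finset.sum_eq_single x]
  · split_ifs <;> grind
  · intro b _ hb
    simp [hb]
  · simp

theorem sum_eMat_kronecker_offdiag (n : ℕ) :
    (∑ i : Fin n, ∑ j : Fin n, if i ≠ j then eMat (i, i) ⊗ₖ eMat (j, j) else 0) =
      Matrix.diagonal fun u : Fin n × Fin n => if u.1 = u.2 then (0 : ℂ) else 1 := by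
  ext ⟨x, y⟩ ⟨x', y'⟩
  simp only [Matrix.sum_apply, Matrix.diagonal_apply]
  rw [Finset.sum_eq_single x, Finset.sum_eq_single y]
  · by_cases h : x = y
    · simp [h]
    · simp only [ne_eq, h, not_false_eq_true, if_true, kroneckerMap_apply, eMat_apply]
      split_ifs <;> grind
  · intro b _ hb
    split_ifs <;> simp [eMat_apply, hb]
  · simp
  · intro b _ hb
    refine Finset.sum_eq_zero fun c _ => ?_
    split_ifs <;> simp [eMat_apply, hb]
  · simp

theorem sum_eMat_kronecker_low (n : ℕ) :
    (∑ i : Fin n, ∑ j : Fin n, if j < i then eMat (i, j) ⊗ₖ eMat (j, i) else 0) =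
      lowFlip n := by
  ext ⟨x, y⟩ ⟨x', y'⟩
  simp only [Matrix.sum_apply, lowFlip, Matrix.of_apply]
  rw [Finset.sum_eq_single x, Finset.sum_eq_single y]
  · by_cases h : y < x
    · simp only [h, if_true, kroneckerMap_apply, eMat_apply, Prod.swap]
      split_ifs <;> grind
    · simp [h]
  · intro b _ hb
    split_ifs <;> simp [eMat_apply, hb]
  · simp
  · intro b _ hb
    refine Finset.sum_eq_zero fun c _ => ?_
    split_ifs <;> simp [eMat_apply, hb]
  · simp

theorem rStd_eq (n : ℕ) :
    rStd n = Matrix.diagonal (fun u : Fin n × Fin n => if u.1 = u.2 then (1 / 2 : ℂ) else 0) +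
      lowFlip n := by
  rw [rStd, sum_eMat_kronecker_diag, ← sum_eMat_kronecker_low, Finset.sum_comm]
  congr 1
  ext u v
  simp [Matrix.diagonal_apply]

theorem RStd_eq (n : ℕ) (ħ : ℂ) :
    RStd n ħ = Matrix.diagonal (fun u : Fin n × Fin n => if u.1 = u.2 then Complex.exp ħ else 1) +
      qdiff ħ • lowFlip n := by
  rw [RStd, sum_eMat_kronecker_diag, sum_eMat_kronecker_offdiag, sum_eMat_kronecker_low]
  congr 1
  ext u v
  simp only [Matrix.add_apply, Matrix.smul_apply, Matrix.diagonal_apply, smul_eq_mul]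
  split_ifs <;> simp

theorem lowFlip_mul_apply {n : ℕ} (X : Mat2 n) (u v : Fin n × Fin n) :
    (lowFlip n * X) u v = if u.2 < u.1 then X u.swap v else 0 := by
  rw [Matrix.mul_apply, Finset.sum_eq_single u.swap]
  · simp [lowFlip]
  · intro p _ hp
    simp [lowFlip, hp]
  · simp

theorem mul_lowFlip_apply {n : ℕ} (X : Mat2 n) (u v : Fin n × Fin n) :
    (X * lowFlip n) u v = if v.1 < v.2 then X u v.swap else 0 := by
  rw [Matrix.mul_apply, Finset.sum_eq_single v.swap]
  · simp [lowFlip]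
  · intro p _ hp
    have : v ≠ p.swap := fun h => hp (by rw [h, Prod.swap_swap])
    simp [lowFlip, this]
  · simp

namespace BDTriple

variable {n : ℕ} (T : BDTriple n)

theorem AMat_apply (m : ℕ) (ħ : ℂ) (u v : Fin n × Fin n) :
    T.AMat m ħ u v = qdiff ħ * (iverson (T.Pow m (v.2, u.2) (u.1, v.1)) *
      T.sign (v.2, u.2) (u.1, v.1) * qpow ħ (T.K (v.2, u.2) (u.1, v.1))) := by
  rw [AMat, Matrix.smul_apply, smul_eq_mul,
    sum_smul_eMat_kronecker_apply (fun α β => iverson (T.Pow m α β) * T.sign α β *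
      qpow ħ (T.K α β))]

theorem aMat_apply (u v : Fin n × Fin n) :
    T.aMat u v =
      iverson (T.Prec (v.1, u.1) (u.2, v.2)) * T.sign (v.1, u.1) (u.2, v.2) -
        iverson (T.Prec (v.2, u.2) (u.1, v.1)) * T.sign (v.2, u.2) (u.1, v.1) := by
  simp only [aMat, wedge, smul_sub, Finset.sum_sub_distrib, Matrix.sub_apply]
  rw [sum_smul_eMat_kronecker_apply (fun α β => iverson (T.Prec α β) * T.sign α β),
    sum_smul_eMat_kronecker_apply' (fun α β => iverson (T.Prec α β) * T.sign α β)]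

end BDTriple

/-- `x ↦ (x_{21})ᵀ`, an anti-automorphism. -/
def antiflip {n : ℕ} (x : Mat2 n) : Mat2 n := (flip21 x)ᵀ

theorem antiflip_apply {n : ℕ} (x : Mat2 n) (u v : Fin n × Fin n) :
    antiflip x u v = x v.swap u.swap := rfl

theorem flip21_apply {n : ℕ} (x : Mat2 n) (u v : Fin n × Fin n) :
    flip21 x u v = x u.swap v.swap := rfl

theorem flip21_mul {n : ℕ} (x y : Mat2 n) : flip21 (x * y) = flip21 x * flip21 y := by
  ext u v
  simp only [flip21_apply, Matrix.mul_apply]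
  exact (Equiv.sum_comp (Equiv.prodComm (Fin n) (Fin n)) _).symm

theorem flip21_one {n : ℕ} : flip21 (1 : Mat2 n) = 1 := by
  ext u v
  simp [flip21_apply, Matrix.one_apply]

theorem flip21_add {n : ℕ} (x y : Mat2 n) : flip21 (x + y) = flip21 x + flip21 y := rfl

theorem flip21_sub {n : ℕ} (x y : Mat2 n) : flip21 (x - y) = flip21 x - flip21 y := rfl

theorem antiflip_mul {n : ℕ} (x y : Mat2 n) : antiflip (x * y) = antiflip y * antiflip x := by
  rw [antiflip, flip21_mul, transpose_mul]
  rfl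

theorem antiflip_one {n : ℕ} : antiflip (1 : Mat2 n) = 1 := by
  rw [antiflip, flip21_one, transpose_one]

theorem antiflip_add {n : ℕ} (x y : Mat2 n) : antiflip (x + y) = antiflip x + antiflip y := rfl

theorem antiflip_smul {n : ℕ} (c : ℂ) (x : Mat2 n) : antiflip (c • x) = c • antiflip x := rfl

theorem antiflip_flip21 {n : ℕ} (x : Mat2 n) : antiflip (flip21 x) = flip21 (antiflip x) := rfl

theorem antiflip_diagonal {n : ℕ} (d : Fin n × Fin n → ℂ) :
    antiflip (Matrix.diagonal d) = Matrix.diagonal fun u => d u.swap := by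
  ext u v
  simp only [antiflip_apply, Matrix.diagonal_apply, Prod.swap_inj]
  split_ifs <;> simp_all

theorem antiflip_lowFlip (n : ℕ) : antiflip (lowFlip n) = lowFlip n := by
  ext ⟨x, y⟩ ⟨x', y'⟩
  simp only [antiflip_apply, lowFlip, Matrix.of_apply, Prod.swap, Prod.mk.injEq]
  split_ifs <;> grind

theorem antiflip_rStd (n : ℕ) : antiflip (rStd n) = rStd n := by
  rw [rStd_eq, antiflip_add, antiflip_diagonal, antiflip_lowFlip]
  simp only [Prod.fst_swap, Prod.snd_swap, eq_comm]

theorem antiflip_RStd (n : ℕ) (ħ : ℂ) : antiflip (RStd n ħ) = RStd n ħ := by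
  rw [RStd_eq, antiflip_add, antiflip_diagonal, antiflip_smul, antiflip_lowFlip]
  simp only [Prod.fst_swap, Prod.snd_swap, eq_comm]

theorem rootVec_apply {n : ℕ} (p : Fin n × Fin n) (j : Fin n) :
    rootVec p j = (if j.val = p.1.val then 1 else 0) - if j.val = p.2.val then 1 else 0 := by
  simp only [rootVec, Pi.sub_apply, Pi.single_apply, Fin.ext_iff]

theorem rootVec_eq_iff {n : ℕ} {β : Fin n × Fin n} (hβ : β.1 < β.2) {a b : ℕ} :
    (fun j : Fin n => (if j.val = a then (1 : ℂ) else 0) - if j.val = b then 1 else 0) =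
      rootVec β ↔ β.1.val = a ∧ β.2.val = b := by
  constructor
  · intro h
    have h1 := congrFun h β.1
    have h2 := congrFun h β.2
    have h3 : β.1.val ≠ β.2.val := by have := Fin.lt_def.1 hβ; omega
    simp only [rootVec_apply, h3, h3.symm, if_true, if_false] at h1 h2
    constructor
    · by_contra hc
      rw [if_neg hc] at h1
      split_ifs at h1 <;> norm_num at h1
    · by_contra hc
      rw [if_neg hc] at h2
      split_ifs at h2 <;> norm_num at h2
  · rintro ⟨rfl, rfl⟩
    ext j
    rw [rootVec_apply]

namespace BDTriple

variable {n : ℕ}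

theorem sum_simpleRoot_τ (T : BDTriple n) (h : ℕ → Fin n → ℂ)
    (hh : ∀ k : T.Γ₁, simpleRoot (T.τ k).1 = h k.1.val - h (k.1.val + 1)) {α : Fin n × Fin n}
    (hα : α.1 < α.2)
    (hm : ∀ k : Fin (n - 1), α.1.val ≤ k.val → k.val < α.2.val → k ∈ T.Γ₁) :
    (∑ k : T.Γ₁, if α.1.val ≤ k.1.val ∧ k.1.val < α.2.val then simpleRoot (T.τ k).1 else 0) =
      h α.1.val - h α.2.val := by
  have htel : ∀ a b : ℕ, a ≤ b → ∑ k ∈ Finset.Ico a b, (h k - h (k + 1)) = h a - h b := by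
    intro a b hab
    induction b, hab using Nat.le_induction with
    | base => simp
    | succ b hab ih => rw [Finset.sum_Ico_succ_top hab, ih]; abel
  rw [← htel _ _ (Fin.lt_def.1 hα).le, ← Finset.sum_filter]
  refine Finset.sum_bij (fun k _ => k.1.val) ?_ ?_ ?_ ?_
  · intro k hk
    simpa using hk
  · intro a _ b _ hab
    exact Subtype.ext (Fin.ext hab)
  · intro b hb
    rw [Finset.mem_Ico] at hb
    have := α.2.isLt
    have hb' : b < n - 1 := by omega
    exact ⟨⟨⟨b, hb'⟩, hm ⟨b, hb'⟩ hb.1 hb.2⟩, by simpa using hb, rfl⟩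
  · intro k _
    exact hh k

theorem cremmerGervais_step_iff (α β : Fin n × Fin n) :
    (cremmerGervais n).Step α β ↔
      α.1 < α.2 ∧ β.1.val = α.1.val + 1 ∧ β.2.val = α.2.val + 1 := by
  have key := (cremmerGervais n).sum_simpleRoot_τ
    (fun k j => if j.val = k + 1 then 1 else 0) (by
      intro k
      ext j
      simp only [simpleRoot, rootVec_apply, Pi.sub_apply]
      rfl) (α := α)
  constructor
  · rintro ⟨h1, h2, h3, h4⟩
    rw [key h1 h3] at h4
    exact ⟨h1, (rootVec_eq_iff h2).1 h4⟩
  · rintro ⟨h1, h2, h3⟩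
    have h4 : β.1 < β.2 := by rw [Fin.lt_def] at *; omega
    have h5 : ∀ k : Fin (n - 1), α.1.val ≤ k.val → k.val < α.2.val →
        k ∈ (cremmerGervais n).Γ₁ := by
      intro k _ hk
      have := β.2.isLt
      simp only [cremmerGervais, Finset.mem_filter, Finset.mem_univ, true_and]
      omega
    refine ⟨h1, h4, h5, ?_⟩
    rw [key h1 h5]
    exact (rootVec_eq_iff h4).2 ⟨h2, h3⟩

theorem inverse_cremmerGervais_step_iff (α β : Fin n × Fin n) :
    (cremmerGervais n).inverse.Step α β ↔
      α.1 < α.2 ∧ α.1.val = β.1.val + 1 ∧ α.2.val = β.2.val + 1 := by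
  have key := (cremmerGervais n).inverse.sum_simpleRoot_τ
    (fun k j => if j.val = k - 1 then 1 else 0) (by
      rintro ⟨k, hk⟩
      have hk' : 0 < k.val := (Finset.mem_filter.1 hk).2
      ext j
      simp only [simpleRoot, rootVec_apply, Pi.sub_apply]
      have e1 : ((cremmerGervais n).inverse.τ ⟨k, hk⟩).1.val = k.val - 1 := rfl
      simp only [simplePair, e1]
      rw [Nat.sub_add_cancel hk', Nat.add_sub_cancel]) (α := α)
  constructor
  · rintro ⟨h1, h2, h3, h4⟩
    rw [key h1 h3] at h4
    have h5 : α.1.val < n - 1 := by have := α.2.isLt; have := Fin.lt_def.1 h1; omega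
    have h6 : 0 < α.1.val :=
      (Finset.mem_filter.1 (h3 ⟨α.1.val, h5⟩ le_rfl (Fin.lt_def.1 h1))).2
    obtain ⟨h7, h8⟩ := (rootVec_eq_iff h2).1 h4
    exact ⟨h1, by omega, by omega⟩
  · rintro ⟨h1, h2, h3⟩
    have h4 : β.1 < β.2 := by rw [Fin.lt_def] at *; omega
    have h5 : ∀ k : Fin (n - 1), α.1.val ≤ k.val → k.val < α.2.val →
        k ∈ (cremmerGervais n).inverse.Γ₁ := by
      intro k hk _
      refine Finset.mem_filter.2 ⟨Finset.mem_univ _, ?_⟩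
      omega
    refine ⟨h1, h4, h5, ?_⟩
    rw [key h1 h5]
    exact (rootVec_eq_iff h4).2 ⟨by omega, by omega⟩

theorem cremmerGervais_pow_succ_iff (m : ℕ) (α β : Fin n × Fin n) :
    (cremmerGervais n).Pow (m + 1) α β ↔
      α.1 < α.2 ∧ β.1.val = α.1.val + (m + 1) ∧ β.2.val = α.2.val + (m + 1) := by
  induction m generalizing α with
  | zero =>
    simp only [Pow, cremmerGervais_step_iff, exists_eq_right]
  | succ m ih =>
    rw [Pow]
    simp only [ih, cremmerGervais_step_iff]
    constructor
    · rintro ⟨γ, ⟨h1, h2, h3⟩, h4, h5, h6⟩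
      exact ⟨h1, by omega, by omega⟩
    · rintro ⟨h1, h2, h3⟩
      have h4 := β.1.isLt
      have h5 := β.2.isLt
      have h6 := Fin.lt_def.1 h1
      refine ⟨(⟨α.1.val + 1, by omega⟩, ⟨α.2.val + 1, by omega⟩), ⟨h1, rfl, rfl⟩, ?_, ?_, ?_⟩
      · rw [Fin.lt_def]; dsimp only; omega
      · dsimp only; omega
      · dsimp only; omega

theorem inverse_cremmerGervais_pow_succ_iff (m : ℕ) (α β : Fin n × Fin n) :
    (cremmerGervais n).inverse.Pow (m + 1) α β ↔
      α.1 < α.2 ∧ α.1.val = β.1.val + (m + 1) ∧ α.2.val = β.2.val + (m + 1) := by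
  induction m generalizing α with
  | zero =>
    simp only [Pow, inverse_cremmerGervais_step_iff, exists_eq_right]
  | succ m ih =>
    rw [Pow]
    simp only [ih, inverse_cremmerGervais_step_iff]
    constructor
    · rintro ⟨γ, ⟨h1, h2, h3⟩, h4, h5, h6⟩
      exact ⟨h1, by omega, by omega⟩
    · rintro ⟨h1, h2, h3⟩
      have h4 := α.1.isLt
      have h5 := α.2.isLt
      have h6 := Fin.lt_def.1 h1
      refine ⟨(⟨α.1.val - 1, by omega⟩, ⟨α.2.val - 1, by omega⟩), ⟨h1, ?_, ?_⟩, ?_, ?_, ?_⟩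
      · dsimp only; omega
      · dsimp only; omega
      · rw [Fin.lt_def]; dsimp only; omega
      · dsimp only; omega
      · dsimp only; omega

theorem prec_iff (T : BDTriple n) (α β : Fin n × Fin n) :
    T.Prec α β ↔ ∃ m, T.Pow (m + 1) α β := by
  constructor
  · rintro ⟨m, hm, h⟩
    exact ⟨m - 1, by rwa [Nat.sub_add_cancel hm]⟩
  · rintro ⟨m, h⟩
    exact ⟨m + 1, by omega, h⟩

theorem cremmerGervais_prec_iff (α β : Fin n × Fin n) :
    (cremmerGervais n).Prec α β ↔ α.1 < α.2 ∧ α.1 < β.1 ∧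
      β.1.val + α.2.val = α.1.val + β.2.val := by
  simp only [prec_iff, cremmerGervais_pow_succ_iff, Fin.lt_def]
  constructor
  · rintro ⟨m, h1, h2, h3⟩
    omega
  · rintro ⟨h1, h2, h3⟩
    exact ⟨β.1.val - α.1.val - 1, by omega, by omega, by omega⟩

theorem inverse_cremmerGervais_prec_iff (α β : Fin n × Fin n) :
    (cremmerGervais n).inverse.Prec α β ↔ α.1 < α.2 ∧ β.1 < α.1 ∧
      β.1.val + α.2.val = α.1.val + β.2.val := by
  simp only [prec_iff, inverse_cremmerGervais_pow_succ_iff, Fin.lt_def]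
  constructor
  · rintro ⟨m, h1, h2, h3⟩
    omega
  · rintro ⟨h1, h2, h3⟩
    exact ⟨α.1.val - β.1.val - 1, by omega, by omega, by omega⟩

theorem cremmerGervais_not_precRev (α β : Fin n × Fin n) :
    ¬(cremmerGervais n).PrecRev α β := by
  rintro ⟨h, m, hm, h1, a, b, ha, hb, h2⟩
  obtain ⟨m, rfl⟩ := Nat.exists_eq_add_of_le' hm
  rw [cremmerGervais_pow_succ_iff] at h1 h2
  simp only [simplePair, rootLen] at h h2
  omega

theorem inverse_cremmerGervais_not_precRev (α β : Fin n × Fin n) :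
    ¬(cremmerGervais n).inverse.PrecRev α β := by
  rintro ⟨h, m, hm, h1, a, b, ha, hb, h2⟩
  obtain ⟨m, rfl⟩ := Nat.exists_eq_add_of_le' hm
  rw [inverse_cremmerGervais_pow_succ_iff] at h1 h2
  simp only [simplePair, rootLen] at h h2
  omega

theorem cremmerGervais_sign (α β : Fin n × Fin n) : (cremmerGervais n).sign α β = 1 :=
  if_neg (cremmerGervais_not_precRev α β)

theorem inverse_cremmerGervais_sign (α β : Fin n × Fin n) :
    (cremmerGervais n).inverse.sign α β = 1 :=
  if_neg (inverse_cremmerGervais_not_precRev α β)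

end BDTriple

/-- The exponent `½[x = y] + [y < x]` at `u = (x, y)`. -/
def heightExp {n : ℕ} (u : Fin n × Fin n) : ℂ :=
  if u.1 = u.2 then 1 / 2 else if u.2 < u.1 then 1 else 0

/-- The row index `u = (x, y)` lies strictly inside the column index `v = (x', y')`, and
`x' < y'`. -/
def Inside {n : ℕ} (u v : Fin n × Fin n) : Prop :=
  u.1.val + u.2.val = v.1.val + v.2.val ∧ v.1 < u.1 ∧ v.1 < u.2

namespace BDTriple

variable {n : ℕ}

theorem cremmerGervais_K {α β : Fin n × Fin n} (h : (cremmerGervais n).Prec α β) :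
    (cremmerGervais n).K α β = heightExp (β.1, α.2) := by
  have h' := h
  simp only [cremmerGervais_prec_iff, Fin.lt_def] at h'
  rw [K, iverson_false (cremmerGervais_not_precRev α β)]
  rw [iverson_false (p := Lessdot β α ∧ _) (by
    rintro ⟨h1, _⟩
    have := congrArg Fin.val h1
    omega)]
  rw [iverson_false (p := ∃ γ, _ ∧ _ ∧ Lessdot γ α) (by
    rintro ⟨γ, h1, _, h2⟩
    simp only [cremmerGervais_prec_iff, Fin.lt_def] at h1
    have := congrArg Fin.val h2
    omega)]
  rcases lt_trichotomy β.1.val α.2.val with h1 | h1 | h1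
  · rw [iverson_false (by
      rintro ⟨h2, _⟩
      have := congrArg Fin.val h2
      omega), iverson_false (by
      rintro ⟨γ, h2, h3, h4⟩
      simp only [cremmerGervais_prec_iff, Fin.lt_def] at h2 h3
      have := congrArg Fin.val h4
      omega), heightExp, if_neg (by rw [Fin.ext_iff]; exact h1.ne),
      if_neg (by rw [Fin.lt_def]; exact h1.le.not_gt)]
    ring
  · rw [iverson_true ⟨Fin.ext h1.symm, h⟩, iverson_false (by
      rintro ⟨γ, h2, h3, h4⟩
      simp only [cremmerGervais_prec_iff, Fin.lt_def] at h2 h3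
      have := congrArg Fin.val h4
      omega), heightExp, if_pos (Fin.ext h1)]
    ring
  · rw [iverson_false (by
      rintro ⟨h2, _⟩
      have := congrArg Fin.val h2
      omega), iverson_true (by
      have := β.2.isLt
      refine ⟨(α.2, ⟨α.2.val + α.2.val - α.1.val, by omega⟩), ?_, ?_, rfl⟩ <;>
        simp only [cremmerGervais_prec_iff, Fin.lt_def] <;> omega),
      heightExp, if_neg (by rw [Fin.ext_iff]; exact h1.ne'),
      if_pos (by rw [Fin.lt_def]; exact h1)]
    ring

theorem inverse_cremmerGervais_K {α β : Fin n × Fin n}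
    (h : (cremmerGervais n).inverse.Prec α β) :
    (cremmerGervais n).inverse.K α β = -heightExp (α.1, β.2) := by
  have h' := h
  simp only [inverse_cremmerGervais_prec_iff, Fin.lt_def] at h'
  rw [K, iverson_false (inverse_cremmerGervais_not_precRev α β)]
  rw [iverson_false (p := Lessdot α β ∧ _) (by
    rintro ⟨h1, _⟩
    have := congrArg Fin.val h1
    omega)]
  rw [iverson_false (p := ∃ γ, _ ∧ _ ∧ Lessdot α γ) (by
    rintro ⟨γ, h1, _, h2⟩
    simp only [inverse_cremmerGervais_prec_iff, Fin.lt_def] at h1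
    have := congrArg Fin.val h2
    omega)]
  rcases lt_trichotomy α.1.val β.2.val with h1 | h1 | h1
  · rw [iverson_false (by
      rintro ⟨h2, _⟩
      have := congrArg Fin.val h2
      omega), iverson_false (by
      rintro ⟨γ, h2, h3, h4⟩
      simp only [inverse_cremmerGervais_prec_iff, Fin.lt_def] at h2 h3
      have := congrArg Fin.val h4
      omega), heightExp, if_neg (by rw [Fin.ext_iff]; exact h1.ne),
      if_neg (by rw [Fin.lt_def]; exact h1.le.not_gt)]
    ring
  · rw [iverson_true ⟨Fin.ext h1.symm, h⟩, iverson_false (by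
      rintro ⟨γ, h2, h3, h4⟩
      simp only [inverse_cremmerGervais_prec_iff, Fin.lt_def] at h2 h3
      have := congrArg Fin.val h4
      omega), heightExp, if_pos (Fin.ext h1)]
    ring
  · rw [iverson_false (by
      rintro ⟨h2, _⟩
      have := congrArg Fin.val h2
      omega), iverson_true (by
      refine ⟨(⟨α.1.val + α.1.val - α.2.val, by omega⟩, α.1), ?_, ?_, rfl⟩ <;>
        simp only [inverse_cremmerGervais_prec_iff, Fin.lt_def] <;> omega),
      heightExp, if_neg (by rw [Fin.ext_iff]; exact h1.ne'),
      if_pos (by rw [Fin.lt_def]; exact h1)]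
    ring

end BDTriple

theorem inside_swap_left {n : ℕ} (u v : Fin n × Fin n) : Inside u.swap v ↔ Inside u v := by
  simp only [Inside, Prod.fst_swap, Prod.snd_swap, Fin.lt_def]
  omega

theorem Inside.lt {n : ℕ} {u v : Fin n × Fin n} (h : Inside u v) : v.1 < v.2 := by
  simp only [Inside, Fin.lt_def] at *
  omega

theorem Inside.not_swap {n : ℕ} {u v : Fin n × Fin n} (h : Inside u v) : ¬Inside u v.swap :=
  fun h' => (h.lt.trans h'.lt).false

/-- The matrix `∑_{α ≺ β} e_{-α} ∧ e_β` of the Cremmer-Gervais triple. -/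
def cgA (n : ℕ) : Mat2 n :=
  Matrix.of fun u v => iverson (Inside u v) - iverson (Inside u v.swap)

theorem cgA_apply {n : ℕ} (u v : Fin n × Fin n) :
    cgA n u v = iverson (Inside u v) - iverson (Inside u v.swap) := rfl

theorem cgA_swap_left {n : ℕ} (u v : Fin n × Fin n) : cgA n u.swap v = cgA n u v := by
  simp only [cgA_apply, inside_swap_left]

theorem cgA_swap_right {n : ℕ} (u v : Fin n × Fin n) : cgA n u v.swap = -cgA n u v := by
  simp only [cgA_apply, Prod.swap_swap, neg_sub]

theorem sum_eq_zero_of_swap {n : ℕ} (F : Fin n × Fin n → ℂ) (h : ∀ p, F p.swap = -F p) :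
    ∑ p, F p = 0 := by
  have h1 : ∑ p : Fin n × Fin n, F p.swap = ∑ p, F p := Equiv.sum_comp (Equiv.prodComm (Fin n) (Fin n)) F
  simp only [h, Finset.sum_neg_distrib] at h1
  exact neg_eq_self.1 h1

theorem cgA_mul_cgA (n : ℕ) : cgA n * cgA n = 0 := by
  ext u v
  rw [Matrix.mul_apply]
  refine sum_eq_zero_of_swap (fun p => cgA n u p * cgA n p v) fun p => ?_
  rw [cgA_swap_left, cgA_swap_right, neg_mul]

theorem cgA_mul_lowFlip_apply {n : ℕ} (u v : Fin n × Fin n) :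
    (cgA n * lowFlip n) u v = if v.1 < v.2 then -cgA n u v else 0 := by
  rw [mul_lowFlip_apply, cgA_swap_right]

theorem lowFlip_mul_cgA_apply {n : ℕ} (u v : Fin n × Fin n) :
    (lowFlip n * cgA n) u v = if u.2 < u.1 then cgA n u v else 0 := by
  rw [lowFlip_mul_apply, cgA_swap_left]

theorem cgA_diag {n : ℕ} (u v : Fin n × Fin n) (h : v.1 = v.2) : cgA n u v = 0 := by
  rw [cgA_apply, iverson_false, iverson_false, sub_zero]
  · intro h'
    exact h'.lt.ne h.symm
  · intro h'
    exact h'.lt.ne h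

theorem cremmerGervais_aMat (n : ℕ) : (BDTriple.cremmerGervais n).aMat = cgA n := by
  ext u v
  rw [BDTriple.aMat_apply, cgA_apply]
  simp only [BDTriple.cremmerGervais_prec_iff, BDTriple.cremmerGervais_sign, mul_one, Inside,
    Prod.fst_swap, Prod.snd_swap, Fin.lt_def]
  congr 2 <;> apply propext <;> omega

theorem inverse_cremmerGervais_aMat (n : ℕ) :
    (BDTriple.cremmerGervais n).inverse.aMat = antiflip (cgA n) := by
  ext u v
  rw [BDTriple.aMat_apply, antiflip_apply, cgA_apply]
  simp only [BDTriple.inverse_cremmerGervais_prec_iff, BDTriple.inverse_cremmerGervais_sign,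
    mul_one, Inside, Prod.fst_swap, Prod.snd_swap, Fin.lt_def]
  congr 2 <;> apply propext <;> omega

theorem heightExp_eq {n : ℕ} (u : Fin n × Fin n) :
    heightExp u = (if u.1 = u.2 then 1 / 2 else 0) + if u.2 < u.1 then 1 else 0 := by
  rw [heightExp]
  split_ifs with h1 h2
  · exact absurd h1 h2.ne'
  all_goals ring

theorem cremmerGervais_epsMat_apply {n : ℕ} (u v : Fin n × Fin n) :
    (BDTriple.cremmerGervais n).epsMat u v =
      (heightExp u - if v.1 < v.2 then 1 else 0) * cgA n u v := by
  rw [BDTriple.epsMat, cremmerGervais_aMat, cgA_mul_cgA, rStd_eq, Matrix.mul_add, Matrix.add_mul,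
    add_zero]
  simp only [Matrix.add_apply, Matrix.mul_diagonal, Matrix.diagonal_mul, cgA_mul_lowFlip_apply,
    lowFlip_mul_cgA_apply, heightExp_eq]
  by_cases h : v.1 = v.2
  · simp [cgA_diag u v h]
  · rw [if_neg h]
    split_ifs <;> ring

theorem inverse_cremmerGervais_epsMat (n : ℕ) :
    (BDTriple.cremmerGervais n).inverse.epsMat =
      antiflip (BDTriple.cremmerGervais n).epsMat := by
  simp only [BDTriple.epsMat, inverse_cremmerGervais_aMat, cremmerGervais_aMat, antiflip_add,
    antiflip_mul, antiflip_rStd]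
  rw [add_comm (rStd n * _)]

theorem cremmerGervais_aTilde_apply {n : ℕ} (ħ : ℂ) (u v : Fin n × Fin n) :
    (BDTriple.cremmerGervais n).aTilde ħ u v =
      iverson (Inside u v) * qpow ħ (heightExp u - 1) -
        iverson (Inside u v.swap) * qpow ħ (heightExp u) := by
  rw [BDTriple.aTilde, Matrix.of_apply, cremmerGervais_epsMat_apply, cremmerGervais_aMat,
    cgA_apply]
  by_cases h : Inside u v
  · simp [iverson_true h, iverson_false h.not_swap, h.lt]
  · by_cases h' : Inside u v.swap
    · have := h'.lt
      simp only [Prod.fst_swap, Prod.snd_swap] at this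
      simp [iverson_true h', iverson_false h, this.le.not_gt]
    · simp [iverson_false h, iverson_false h']

theorem inverse_cremmerGervais_aTilde (n : ℕ) (ħ : ℂ) :
    (BDTriple.cremmerGervais n).inverse.aTilde ħ =
      antiflip ((BDTriple.cremmerGervais n).aTilde ħ) := by
  ext u v
  rw [antiflip_apply, BDTriple.aTilde, BDTriple.aTilde, inverse_cremmerGervais_epsMat,
    inverse_cremmerGervais_aMat, cremmerGervais_aMat]
  rfl

theorem qpow_zero (ħ : ℂ) : qpow ħ 0 = 1 := by simp [qpow]

theorem qpow_one (ħ : ℂ) : qpow ħ 1 = Complex.exp ħ := by simp [qpow]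

theorem qpow_add (ħ x y : ℂ) : qpow ħ (x + y) = qpow ħ x * qpow ħ y := by
  rw [qpow, qpow, qpow, ← Complex.exp_add, mul_add]

theorem qpow_ne_zero (ħ x : ℂ) : qpow ħ x ≠ 0 := Complex.exp_ne_zero _

theorem qdiff_eq (ħ : ℂ) : qdiff ħ = qpow ħ 1 - qpow ħ (-1) := by simp [qdiff, qpow]

theorem qpow_one_mul_neg_one (ħ : ℂ) : qpow ħ 1 * qpow ħ (-1) = 1 := by
  rw [← qpow_add, add_neg_cancel, qpow_zero]

/-- For `ε = 1`, the sum of the matrices `A^m` of the Cremmer-Gervais triple; for `ε = -1`, the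
one of the inverse triple, up to `antiflip`. -/
def cgJ (n : ℕ) (ε ħ : ℂ) : Mat2 n :=
  Matrix.of fun u v => qdiff ħ * (iverson (Inside u v.swap) * qpow ħ (ε * heightExp u))

theorem cgJ_apply {n : ℕ} (ε ħ : ℂ) (u v : Fin n × Fin n) :
    cgJ n ε ħ u v = qdiff ħ * (iverson (Inside u v.swap) * qpow ħ (ε * heightExp u)) := rfl

theorem heightExp_of_lt {n : ℕ} {u : Fin n × Fin n} (h : u.1 < u.2) : heightExp u = 0 := by
  rw [heightExp, if_neg h.ne, if_neg h.le.not_gt]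

theorem heightExp_of_eq {n : ℕ} {u : Fin n × Fin n} (h : u.1 = u.2) : heightExp u = 1 / 2 :=
  if_pos h

theorem heightExp_of_gt {n : ℕ} {u : Fin n × Fin n} (h : u.2 < u.1) : heightExp u = 1 := by
  rw [heightExp, if_neg h.ne', if_pos h]

theorem aTilde_mul_eq_zero {n : ℕ} (ħ : ℂ) (X : Mat2 n)
    (h : ∀ p v : Fin n × Fin n, p.1 < p.2 → X p v = qpow ħ 1 * X p.swap v) :
    (BDTriple.cremmerGervais n).aTilde ħ * X = 0 := by
  ext u v
  rw [Matrix.mul_apply]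
  refine sum_eq_zero_of_swap _ fun p => ?_
  rw [cremmerGervais_aTilde_apply, cremmerGervais_aTilde_apply, Prod.swap_swap]
  have e : qpow ħ (heightExp u) = qpow ħ (heightExp u - 1) * qpow ħ 1 := by
    rw [← qpow_add, sub_add_cancel]
  by_cases h1 : Inside u p
  · rw [iverson_true h1, iverson_false h1.not_swap, h p v h1.lt, e]
    ring
  · by_cases h2 : Inside u p.swap
    · have h3 := h p.swap v h2.lt
      rw [Prod.swap_swap] at h3
      rw [iverson_true h2, iverson_false h1, h3, e]
      ring
    · rw [iverson_false h1, iverson_false h2]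
      ring

theorem aTilde_mul_flip21_cgJ (n : ℕ) (ħ : ℂ) :
    (BDTriple.cremmerGervais n).aTilde ħ * flip21 (cgJ n 1 ħ) = 0 := by
  refine aTilde_mul_eq_zero ħ _ fun p v hp => ?_
  simp only [flip21_apply, cgJ_apply, Prod.swap_swap, inside_swap_left]
  rw [heightExp_of_lt hp, heightExp_of_gt (u := p.swap) hp, mul_zero, qpow_zero, mul_one]
  ring

theorem aTilde_mul_cgJ_neg (n : ℕ) (ħ : ℂ) :
    (BDTriple.cremmerGervais n).aTilde ħ * cgJ n (-1) ħ = 0 := by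
  refine aTilde_mul_eq_zero ħ _ fun p v hp => ?_
  simp only [cgJ_apply, inside_swap_left]
  rw [heightExp_of_lt hp, heightExp_of_gt (u := p.swap) hp, mul_zero, qpow_zero,
    mul_one (-1 : ℂ)]
  linear_combination (-qdiff ħ * iverson (Inside p v.swap)) * qpow_one_mul_neg_one ħ

theorem cgJ_mul_RStd {n : ℕ} (ħ : ℂ) :
    (1 - cgJ n 1 ħ) * RStd n ħ =
      (RStd n ħ + qdiff ħ • (BDTriple.cremmerGervais n).aTilde ħ) *
        (1 - flip21 (cgJ n 1 ħ)) := by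
  rw [Matrix.sub_mul, Matrix.mul_sub, Matrix.mul_one, Matrix.add_mul, Matrix.smul_mul,
    aTilde_mul_flip21_cgJ, Matrix.one_mul, smul_zero, add_zero]
  simp only [RStd_eq, Matrix.mul_add, Matrix.add_mul, Matrix.mul_smul, Matrix.smul_mul]
  ext u v
  simp only [Matrix.add_apply, Matrix.sub_apply, Matrix.smul_apply, Matrix.mul_diagonal,
    Matrix.diagonal_mul, mul_lowFlip_apply, lowFlip_mul_apply, flip21_apply, cgJ_apply,
    Prod.swap_swap, inside_swap_left, cremmerGervais_aTilde_apply, smul_eq_mul, one_mul,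
    qdiff_eq, ← qpow_one]
  have e1 : qpow ħ (1 / 2 - 1) = qpow ħ (1 / 2) * qpow ħ (-1) := by
    rw [← qpow_add]; norm_num
  have e2 : qpow ħ (0 - 1) = qpow ħ (-1) := by norm_num
  by_cases h1 : Inside u v
  · rw [iverson_true h1, iverson_false h1.not_swap, if_pos h1.lt]
    rcases lt_trichotomy u.1 u.2 with h | h | h
    · rw [heightExp_of_lt h, heightExp_of_gt (u := u.swap) h, if_neg h.ne, if_neg h.le.not_gt, e2,
        qpow_zero]
      ring
    · rw [heightExp_of_eq h, heightExp_of_eq (u := u.swap) h.symm, if_pos h, if_neg h.not_gt,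
        e1]
      ring
    · rw [heightExp_of_gt h, heightExp_of_lt (u := u.swap) h, if_neg h.ne', if_pos h, sub_self,
        qpow_zero]
      ring
  · by_cases h2 : Inside u v.swap
    · have h3 : v.2 < v.1 := h2.lt
      rw [iverson_true h2, iverson_false h1, if_neg h3.le.not_gt, if_neg h3.ne']
      simp
      ring
    · rw [iverson_false h1, iverson_false h2]
      simp

theorem cgJ_neg_mul_RStd {n : ℕ} (ħ : ℂ) :
    (1 + flip21 (cgJ n (-1) ħ)) * RStd n ħ =
      (RStd n ħ + qdiff ħ • (BDTriple.cremmerGervais n).aTilde ħ) * (1 + cgJ n (-1) ħ) := by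
  rw [Matrix.add_mul, Matrix.mul_add, Matrix.mul_one, Matrix.add_mul _ _ (cgJ n (-1) ħ), Matrix.smul_mul,
    aTilde_mul_cgJ_neg, Matrix.one_mul, smul_zero, add_zero]
  simp only [RStd_eq, Matrix.mul_add, Matrix.add_mul, Matrix.mul_smul, Matrix.smul_mul]
  ext u v
  simp only [Matrix.add_apply, Matrix.smul_apply, Matrix.mul_diagonal,
    Matrix.diagonal_mul, mul_lowFlip_apply, lowFlip_mul_apply, flip21_apply, cgJ_apply,
    Prod.swap_swap, inside_swap_left, cremmerGervais_aTilde_apply, smul_eq_mul,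
    qdiff_eq, ← qpow_one]
  have e1 : qpow ħ (1 / 2 - 1) = qpow ħ (-1 * (1 / 2)) := by norm_num
  have e2 : qpow ħ (0 - 1) = qpow ħ (-1) := by norm_num
  have e3 : qpow ħ (1 / 2) = qpow ħ 1 * qpow ħ (-1 * (1 / 2)) := by
    rw [← qpow_add]; norm_num
  by_cases h1 : Inside u v
  · rw [iverson_true h1, iverson_false h1.not_swap, if_neg h1.lt.ne]
    rcases lt_trichotomy u.1 u.2 with h | h | h
    · rw [heightExp_of_lt h, heightExp_of_gt (u := u.swap) h, e2]
      simp
    · rw [heightExp_of_eq h, heightExp_of_eq (u := u.swap) h.symm, e1]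
      simp
    · rw [heightExp_of_gt h, heightExp_of_lt (u := u.swap) h, sub_self]
      simp
  · by_cases h2 : Inside u v.swap
    · have h3 : v.2 < v.1 := h2.lt
      rw [iverson_true h2, iverson_false h1, if_neg h3.le.not_gt]
      rcases lt_trichotomy u.1 u.2 with h | h | h
      · rw [heightExp_of_lt h, if_neg h.ne, if_neg h.le.not_gt]
        simp
      · rw [heightExp_of_eq h, if_pos h, if_neg h.not_gt, e3]
        simp
        ring
      · rw [heightExp_of_gt h, heightExp_of_lt (u := u.swap) h, if_neg h.ne', if_pos h, mul_zero, qpow_zero]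
        simp
        ring
    · rw [iverson_false h1, iverson_false h2]
      simp

section Products

variable {R : Type*} [Ring R] (A : ℕ → R)

theorem prod_one_add_mul_one_sub_sum (h : ∀ m m', m' ≤ m → A m * A m' = 0) (N : ℕ) :
    ((List.range N).map fun m => 1 + A m).prod * (1 - ∑ m ∈ Finset.range N, A m) = 1 := by
  induction N with
  | zero => simp
  | succ N ih =>
    have h1 : A N * ∑ m ∈ Finset.range N, A m = 0 := by
      rw [Finset.mul_sum]
      exact Finset.sum_eq_zero fun m hm => h _ _ (Finset.mem_range.1 hm).le
    rw [List.range_succ, List.map_append, List.prod_append, Finset.sum_range_succ, mul_assoc]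
    have h2 : ([N].map fun m => 1 + A m).prod * (1 - (∑ m ∈ Finset.range N, A m + A N)) =
        1 - ∑ m ∈ Finset.range N, A m := by
      simp only [List.map_cons, List.map_nil, List.prod_cons, List.prod_nil, mul_one, add_mul,
        one_mul, mul_sub, mul_add, h1, h N N le_rfl]
      abel
    rw [h2, ih]

theorem prod_one_add_eq_one_add_sum (h : ∀ m m', m ≤ m' → A m * A m' = 0) (N : ℕ) :
    ((List.range N).map fun m => 1 + A m).prod = 1 + ∑ m ∈ Finset.range N, A m := by
  induction N with
  | zero => simp
  | succ N ih =>
    have h1 : (∑ m ∈ Finset.range N, A m) * A N = 0 := by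
      rw [Finset.sum_mul]
      exact Finset.sum_eq_zero fun m hm => h _ _ (Finset.mem_range.1 hm).le
    rw [List.range_succ, List.map_append, List.prod_append, Finset.sum_range_succ, ih]
    simp only [List.map_cons, List.map_nil, List.prod_cons, List.prod_nil, mul_one, add_mul,
      one_mul, mul_add, h1]
    abel

theorem isUnit_prod_one_add (h : ∀ m, A m * A m = 0) (N : ℕ) :
    IsUnit ((List.range N).map fun m => 1 + A m).prod := by
  induction N with
  | zero => simp
  | succ N ih =>
    rw [List.range_succ, List.map_append, List.prod_append]
    refine ih.mul ?_
    simp only [List.map_cons, List.map_nil, List.prod_cons, List.prod_nil, mul_one]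
    exact ⟨⟨1 + A N, 1 - A N, by simp [add_mul, mul_sub, h], by simp [sub_mul, mul_add, h]⟩, rfl⟩

end Products

theorem prec_of_pow_succ {n : ℕ} {T : BDTriple n} {m : ℕ} {α β : Fin n × Fin n}
    (h : T.Pow (m + 1) α β) : T.Prec α β := (T.prec_iff α β).2 ⟨m, h⟩

theorem cremmerGervais_AMat_apply {n : ℕ} (m : ℕ) (ħ : ℂ) (u v : Fin n × Fin n) :
    (BDTriple.cremmerGervais n).AMat (m + 1) ħ u v =
      qdiff ħ * (iverson ((BDTriple.cremmerGervais n).Pow (m + 1) (v.2, u.2) (u.1, v.1)) *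
        qpow ħ (heightExp u)) := by
  rw [BDTriple.AMat_apply, BDTriple.cremmerGervais_sign, mul_one]
  by_cases h : (BDTriple.cremmerGervais n).Pow (m + 1) (v.2, u.2) (u.1, v.1)
  · rw [BDTriple.cremmerGervais_K (prec_of_pow_succ h)]
  · simp only [iverson_false h, zero_mul]

theorem inverse_cremmerGervais_AMat_apply {n : ℕ} (m : ℕ) (ħ : ℂ) (u v : Fin n × Fin n) :
    (BDTriple.cremmerGervais n).inverse.AMat (m + 1) ħ u v =
      qdiff ħ *
        (iverson ((BDTriple.cremmerGervais n).inverse.Pow (m + 1) (v.2, u.2) (u.1, v.1)) *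
          qpow ħ (-heightExp v.swap)) := by
  rw [BDTriple.AMat_apply, BDTriple.inverse_cremmerGervais_sign, mul_one]
  by_cases h : (BDTriple.cremmerGervais n).inverse.Pow (m + 1) (v.2, u.2) (u.1, v.1)
  · rw [BDTriple.inverse_cremmerGervais_K (prec_of_pow_succ h)]
    rfl
  · simp only [iverson_false h, zero_mul]

theorem cremmerGervais_AMat_mul_AMat {n : ℕ} (ħ : ℂ) (m m' : ℕ) (h : m' ≤ m) :
    (BDTriple.cremmerGervais n).AMat (m + 1) ħ * (BDTriple.cremmerGervais n).AMat (m' + 1) ħ =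
      0 := by
  ext u v
  rw [Matrix.mul_apply]
  refine Finset.sum_eq_zero fun p _ => ?_
  rw [cremmerGervais_AMat_apply, cremmerGervais_AMat_apply]
  by_cases h1 : (BDTriple.cremmerGervais n).Pow (m + 1) (p.2, u.2) (u.1, p.1)
  · rw [iverson_false (p := BDTriple.Pow _ _ (v.2, p.2) _) fun h2 => ?_]
    · simp
    · simp only [BDTriple.cremmerGervais_pow_succ_iff, Fin.lt_def] at h1 h2
      omega
  · simp [iverson_false h1]

theorem inverse_cremmerGervais_AMat_mul_AMat {n : ℕ} (ħ : ℂ) (m m' : ℕ) (h : m ≤ m') :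
    (BDTriple.cremmerGervais n).inverse.AMat (m + 1) ħ *
      (BDTriple.cremmerGervais n).inverse.AMat (m' + 1) ħ = 0 := by
  ext u v
  rw [Matrix.mul_apply]
  refine Finset.sum_eq_zero fun p _ => ?_
  rw [inverse_cremmerGervais_AMat_apply, inverse_cremmerGervais_AMat_apply]
  by_cases h1 : (BDTriple.cremmerGervais n).inverse.Pow (m + 1) (p.2, u.2) (u.1, p.1)
  · rw [iverson_false (p := BDTriple.Pow _ _ (v.2, p.2) _) fun h2 => ?_]
    · simp
    · simp only [BDTriple.inverse_cremmerGervais_pow_succ_iff, Fin.lt_def] at h1 h2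
      omega
  · simp [iverson_false h1]

theorem sum_iverson_eq {N : ℕ} (P : ℕ → Prop) (Q : Prop) (h1 : ∀ m, P m → Q)
    (h2 : Q → ∃ m < N, P m ∧ ∀ m', P m' → m' = m) :
    ∑ m ∈ Finset.range N, iverson (P m) = iverson Q := by
  by_cases hQ : Q
  · obtain ⟨m, hm, hP, hu⟩ := h2 hQ
    rw [Finset.sum_eq_single m, iverson_true hP, iverson_true hQ]
    · intro b _ hb
      exact iverson_false fun h => hb (hu b h)
    · intro h
      exact absurd (Finset.mem_range.2 hm) h
  · rw [iverson_false hQ]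
    exact Finset.sum_eq_zero fun m _ => iverson_false fun h => hQ (h1 m h)

theorem cremmerGervais_sum_AMat (n : ℕ) (ħ : ℂ) :
    ∑ m ∈ Finset.range n, (BDTriple.cremmerGervais n).AMat (m + 1) ħ = cgJ n 1 ħ := by
  ext u v
  simp only [Matrix.sum_apply, cremmerGervais_AMat_apply, cgJ_apply, ← Finset.mul_sum,
    ← Finset.sum_mul, one_mul]
  congr 2
  refine sum_iverson_eq _ _ ?_ ?_ <;>
    simp only [BDTriple.cremmerGervais_pow_succ_iff, Inside, Prod.fst_swap, Prod.snd_swap,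
      Fin.lt_def]
  · intros
    omega
  · rintro ⟨h1, h2, h3⟩
    have := u.1.isLt
    exact ⟨u.1.val - v.2.val - 1, by omega, by omega, fun m' h => by omega⟩

theorem inverse_cremmerGervais_sum_AMat (n : ℕ) (ħ : ℂ) :
    ∑ m ∈ Finset.range n, (BDTriple.cremmerGervais n).inverse.AMat (m + 1) ħ =
      antiflip (cgJ n (-1) ħ) := by
  ext u v
  simp only [Matrix.sum_apply, inverse_cremmerGervais_AMat_apply, antiflip_apply, cgJ_apply,
    ← Finset.mul_sum, ← Finset.sum_mul, neg_one_mul]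
  congr 2
  refine sum_iverson_eq _ _ ?_ ?_ <;>
    simp only [BDTriple.inverse_cremmerGervais_pow_succ_iff, Inside, Prod.fst_swap,
      Prod.snd_swap, Fin.lt_def]
  · intros
    omega
  · rintro ⟨h1, h2, h3⟩
    have := v.2.isLt
    exact ⟨v.2.val - u.1.val - 1, by omega, by omega, fun m' h => by omega⟩

theorem cremmerGervais_RJ {n : ℕ} (s : Matrix (Fin n) (Fin n) ℂ) (ħ : ℂ) :
    (BDTriple.cremmerGervais n).RJ s ħ = (BDTriple.cremmerGervais n).RGGS s ħ := by
  have hJ : (BDTriple.cremmerGervais n).JMat ħ * (1 - cgJ n 1 ħ) = 1 := by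
    rw [← cremmerGervais_sum_AMat]
    exact prod_one_add_mul_one_sub_sum
      (fun m => (BDTriple.cremmerGervais n).AMat (m + 1) ħ)
      (fun m m' => cremmerGervais_AMat_mul_AMat ħ m m') n
  have hJ' : (1 - flip21 (cgJ n 1 ħ)) * flip21 ((BDTriple.cremmerGervais n).JMat ħ) = 1 := by
    rw [← flip21_one, ← flip21_sub, ← flip21_mul, mul_eq_one_comm.1 hJ]
  rw [BDTriple.RJ, BDTriple.RGGS, Matrix.inv_eq_right_inv hJ, cgJ_mul_RStd, Matrix.mul_assoc
    (RStd n ħ + _), hJ', Matrix.mul_one]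

theorem inverse_cremmerGervais_RGGS {n : ℕ} (s : Matrix (Fin n) (Fin n) ℂ) (ħ : ℂ) :
    (BDTriple.cremmerGervais n).inverse.RGGS s ħ =
      antiflip ((BDTriple.cremmerGervais n).RGGS sᵀ ħ) := by
  rw [BDTriple.RGGS, BDTriple.RGGS, antiflip_mul, antiflip_mul, antiflip_add, antiflip_smul,
    antiflip_RStd, inverse_cremmerGervais_aTilde, qpowRZero, qpowRZero, antiflip_diagonal,
    Matrix.mul_assoc]
  rfl

theorem inverse_cremmerGervais_RJ {n : ℕ} (s : Matrix (Fin n) (Fin n) ℂ) (ħ : ℂ) :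
    (BDTriple.cremmerGervais n).inverse.RJ s ħ =
      (BDTriple.cremmerGervais n).inverse.RGGS s ħ := by
  have hJ : (BDTriple.cremmerGervais n).inverse.JMat ħ = antiflip (1 + cgJ n (-1) ħ) := by
    rw [antiflip_add, antiflip_one, ← inverse_cremmerGervais_sum_AMat]
    exact prod_one_add_eq_one_add_sum
      (fun m => (BDTriple.cremmerGervais n).inverse.AMat (m + 1) ħ)
      (fun m m' => inverse_cremmerGervais_AMat_mul_AMat ħ m m') n
  have hu : IsUnit ((BDTriple.cremmerGervais n).inverse.JMat ħ) :=
    isUnit_prod_one_add (fun m => (BDTriple.cremmerGervais n).inverse.AMat (m + 1) ħ)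
      (fun m => inverse_cremmerGervais_AMat_mul_AMat ħ m m le_rfl) n
  have hM : RStd n ħ * flip21 ((BDTriple.cremmerGervais n).inverse.JMat ħ) =
      (BDTriple.cremmerGervais n).inverse.JMat ħ *
        (RStd n ħ + qdiff ħ • (BDTriple.cremmerGervais n).inverse.aTilde ħ) := by
    have h := congrArg antiflip (cgJ_neg_mul_RStd (n := n) ħ)
    rw [antiflip_mul, antiflip_mul, antiflip_RStd, ← hJ, antiflip_add,
      antiflip_add (RStd n ħ), antiflip_RStd, antiflip_smul,
      ← inverse_cremmerGervais_aTilde] at h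
    rw [← h, hJ]
    congr 1
    rw [← antiflip_flip21, flip21_add, flip21_one, antiflip_add]
  rw [BDTriple.RJ, BDTriple.RGGS, Matrix.mul_assoc _⁻¹, hM, ← Matrix.mul_assoc _⁻¹,
    Matrix.nonsing_inv_mul _ ((Matrix.isUnit_iff_isUnit_det _).1 hu), Matrix.one_mul]

section Jets

theorem pow_isBigO_pow {k l : ℕ} (h : k ≤ l) :
    (fun ħ : ℂ => ħ ^ l) =O[nhds 0] fun ħ => ħ ^ k := by
  rcases h.eq_or_lt with rfl | h
  · exact isBigO_refl _ _
  · exact (isLittleO_pow_pow h).isBigO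

theorem coeff_eq_zero_of_isBigO {c : ℂ} {k : ℕ}
    (h : (fun ħ : ℂ => c * ħ ^ k) =O[nhds 0] fun ħ => ħ ^ (k + 1)) : c = 0 := by
  obtain ⟨C, hC⟩ := h.bound
  have h1 : ∀ᶠ ħ : ℂ in nhdsWithin 0 {0}ᶜ, ‖c‖ ≤ C * ‖ħ‖ := by
    filter_upwards [nhdsWithin_le_nhds hC, self_mem_nhdsWithin] with ħ h2 h3
    have h4 : 0 < ‖ħ‖ ^ k := pow_pos (norm_pos_iff.2 h3) k
    rw [norm_mul, norm_pow, norm_pow, pow_succ] at h2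
    nlinarith
  have h2 : Filter.Tendsto (fun ħ : ℂ => C * ‖ħ‖) (nhdsWithin 0 {0}ᶜ) (nhds 0) := by
    have : Continuous fun ħ : ℂ => C * ‖ħ‖ := by fun_prop
    have h3 := this.tendsto 0
    simp only [norm_zero, mul_zero] at h3
    exact h3.mono_left nhdsWithin_le_nhds
  exact norm_le_zero_iff.1 (ge_of_tendsto h2 h1)

/-- `f ≡ c₀ + c₁ ħ + c₂ ħ² (mod ħ³)` -/
def HasJet (f : ℂ → ℂ) (c₀ c₁ c₂ : ℂ) : Prop :=
  (fun ħ => f ħ - (c₀ + c₁ * ħ + c₂ * ħ ^ 2)) =O[nhds 0] fun ħ => ħ ^ 3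

theorem HasJet.congr_coeff {f : ℂ → ℂ} {c₀ c₁ c₂ d₀ d₁ d₂ : ℂ} (h : HasJet f c₀ c₁ c₂)
    (h₀ : c₀ = d₀) (h₁ : c₁ = d₁) (h₂ : c₂ = d₂) : HasJet f d₀ d₁ d₂ := by
  subst h₀ h₁ h₂
  exact h

theorem HasJet.unique {f : ℂ → ℂ} {c₀ c₁ c₂ d₀ d₁ d₂ : ℂ} (h : HasJet f c₀ c₁ c₂)
    (h' : HasJet f d₀ d₁ d₂) : c₀ = d₀ ∧ c₁ = d₁ ∧ c₂ = d₂ := by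
  have h0 : (fun ħ : ℂ => (c₀ - d₀) + (c₁ - d₁) * ħ + (c₂ - d₂) * ħ ^ 2) =O[nhds 0]
      fun ħ => ħ ^ 3 :=
    (h'.sub h).congr_left fun ħ => by ring
  have e0 : c₀ - d₀ = 0 := by
    refine coeff_eq_zero_of_isBigO (k := 0) ?_
    have h1 := ((pow_isBigO_pow (le_refl 1)).const_mul_left (c₁ - d₁)).add
      ((pow_isBigO_pow (show 1 ≤ 2 by norm_num)).const_mul_left (c₂ - d₂))
    exact ((h0.trans (pow_isBigO_pow (show 1 ≤ 3 by norm_num))).sub h1).congr_left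
      fun ħ => by ring
  have e1 : c₁ - d₁ = 0 := by
    refine coeff_eq_zero_of_isBigO (k := 1) ?_
    have h1 := (pow_isBigO_pow (le_refl 2)).const_mul_left (c₂ - d₂)
    refine ((h0.trans (pow_isBigO_pow (show 2 ≤ 3 by norm_num))).sub h1).congr_left
      fun ħ => ?_
    rw [e0]
    ring
  have e2 : c₂ - d₂ = 0 := by
    refine coeff_eq_zero_of_isBigO (k := 2) (h0.congr_left fun ħ => ?_)
    rw [e0, e1]
    ring
  exact ⟨sub_eq_zero.1 e0, sub_eq_zero.1 e1, sub_eq_zero.1 e2⟩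

theorem hasJet_qpow (y : ℂ) : HasJet (fun ħ => qpow ħ y) 1 y (y ^ 2 / 2) := by
  have h1 : Filter.Tendsto (fun ħ : ℂ => ħ * y) (nhds 0) (nhds 0) := by
    have : Continuous fun ħ : ℂ => ħ * y := by fun_prop
    simpa using this.tendsto 0
  have h2 := (Complex.exp_sub_sum_range_isBigO_pow 3).comp_tendsto h1
  have h3 : (fun ħ : ℂ => (ħ * y) ^ 3) =O[nhds 0] fun ħ => ħ ^ 3 :=
    ((isBigO_refl (fun ħ : ℂ => ħ ^ 3) (nhds 0)).const_mul_left (y ^ 3)).congr_left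
      fun ħ => by ring
  refine (h2.trans h3).congr_left fun ħ => ?_
  simp only [Function.comp, Finset.sum_range_succ, Finset.sum_range_zero, qpow]
  norm_num
  ring

theorem HasJet.const_mul {f : ℂ → ℂ} {c₀ c₁ c₂ : ℂ} (h : HasJet f c₀ c₁ c₂) (x : ℂ) :
    HasJet (fun ħ => x * f ħ) (x * c₀) (x * c₁) (x * c₂) :=
  (h.const_mul_left x).congr_left fun ħ => by ring

theorem HasJet.sub {f g : ℂ → ℂ} {c₀ c₁ c₂ d₀ d₁ d₂ : ℂ} (h : HasJet f c₀ c₁ c₂)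
    (h' : HasJet g d₀ d₁ d₂) : HasJet (fun ħ => f ħ - g ħ) (c₀ - d₀) (c₁ - d₁) (c₂ - d₂) :=
  (IsBigO.sub h h').congr_left fun ħ => by ring

theorem hasJet_qpow_mul_qdiff (y : ℂ) : HasJet (fun ħ => qpow ħ y * qdiff ħ) 0 2 (2 * y) := by
  have e : (fun ħ => qpow ħ y * qdiff ħ) = fun ħ => qpow ħ (y + 1) - qpow ħ (y + -1) := by
    funext ħ
    rw [qdiff_eq, qpow_add, qpow_add]
    ring
  rw [e]
  refine ((hasJet_qpow _).sub (hasJet_qpow _)).congr_coeff ?_ ?_ ?_ <;> ring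

theorem hasJet_form_zero (x y : ℂ) :
    HasJet (fun ħ => x * qpow ħ y * qdiff ħ ^ 0) x (x * y) (x * y ^ 2 / 2) := by
  simp only [pow_zero, mul_one]
  refine ((hasJet_qpow y).const_mul x).congr_coeff ?_ ?_ ?_ <;> ring

theorem hasJet_form_one (x y : ℂ) :
    HasJet (fun ħ => x * qpow ħ y * qdiff ħ ^ 1) 0 (2 * x) (2 * x * y) := by
  simp only [pow_one, mul_assoc]
  refine ((hasJet_qpow_mul_qdiff y).const_mul x).congr_coeff ?_ ?_ ?_ <;> ring

/-- `f` has the form `x q^y (q - q⁻¹)^z` with `z ∈ {0, 1}`. -/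
def IsForm (f : ℂ → ℂ) : Prop :=
  ∃ x y : ℂ, ∃ z : ℕ, (z = 0 ∨ z = 1) ∧ ∀ ħ, f ħ = x * qpow ħ y * qdiff ħ ^ z

theorem IsForm.eq_of_hasJet {f g : ℂ → ℂ} (hf : IsForm f) (hg : IsForm g) {c₀ c₁ c₂ : ℂ}
    (jf : HasJet f c₀ c₁ c₂) (jg : HasJet g c₀ c₁ c₂) : f = g := by
  obtain ⟨x, y, z, hz, hf⟩ := hf
  obtain ⟨x', y', z', hz', hg⟩ := hg
  obtain rfl := funext hf
  obtain rfl := funext hg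
  rcases hz with rfl | rfl <;> rcases hz' with rfl | rfl
  · obtain ⟨h0, h1, -⟩ := jf.unique (hasJet_form_zero x y)
    obtain ⟨h0', h1', -⟩ := jg.unique (hasJet_form_zero x' y')
    rw [h0] at h0'
    subst h0'
    by_cases hx : x = 0
    · simp [hx]
    · rw [h1] at h1'
      rw [mul_left_cancel₀ hx h1']
  · obtain ⟨h0, h1, -⟩ := jf.unique (hasJet_form_zero x y)
    obtain ⟨h0', h1', -⟩ := jg.unique (hasJet_form_one x' y')
    have hx : x = 0 := by rw [← h0, h0']
    have hx' : x' = 0 := by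
      rw [h1, hx, zero_mul] at h1'
      simpa using h1'.symm
    simp [hx, hx']
  · obtain ⟨h0, h1, -⟩ := jf.unique (hasJet_form_one x y)
    obtain ⟨h0', h1', -⟩ := jg.unique (hasJet_form_zero x' y')
    have hx : x' = 0 := by rw [← h0', h0]
    have hx' : x = 0 := by
      rw [h1', hx, zero_mul] at h1
      simpa using h1.symm
    simp [hx, hx']
  · obtain ⟨h0, h1, h2⟩ := jf.unique (hasJet_form_one x y)
    obtain ⟨h0', h1', h2'⟩ := jg.unique (hasJet_form_one x' y')
    have hx : x = x' := by
      rw [h1] at h1'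
      exact mul_left_cancel₀ two_ne_zero h1'
    subst hx
    by_cases hx : x = 0
    · simp [hx]
    · rw [h2] at h2'
      rw [mul_left_cancel₀ (mul_ne_zero two_ne_zero hx) h2']

end Jets

theorem isGGS_iff {n : ℕ} (T : BDTriple n) (s : Matrix (Fin n) (Fin n) ℂ) (R : ℂ → Mat2 n) :
    T.IsGGS s R ↔ ∀ u v, IsForm (fun ħ => R ħ u v) ∧
      HasJet (fun ħ => R ħ u v) ((1 : Mat2 n) u v) (2 * T.rMat s u v)
        (2 * (T.rMat s * T.rMat s) u v) := by
  rw [BDTriple.IsGGS, ← forall_and]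
  refine forall_congr' fun u => ?_
  rw [← forall_and]
  refine forall_congr' fun v => and_congr Iff.rfl ?_
  rw [HasJet]
  refine iff_of_eq ?_
  congr 1
  funext ħ
  simp only [Matrix.add_apply, Matrix.smul_apply, smul_eq_mul]
  ring

theorem isGGS_iff_eq {n : ℕ} {T : BDTriple n} {s : Matrix (Fin n) (Fin n) ℂ} {R₀ : ℂ → Mat2 n}
    (h₀ : T.IsGGS s R₀) (R : ℂ → Mat2 n) : T.IsGGS s R ↔ R = R₀ := by
  refine ⟨fun h => ?_, fun h => h ▸ h₀⟩
  rw [isGGS_iff] at h h₀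
  funext ħ
  ext u v
  exact congrFun ((h u v).1.eq_of_hasJet (h₀ u v).1 (h u v).2 (h₀ u v).2) ħ

theorem rMat_eq {n : ℕ} (s : Matrix (Fin n) (Fin n) ℂ) :
    (BDTriple.cremmerGervais n).rMat s =
      Matrix.diagonal (fun u : Fin n × Fin n => s u.1 u.2 + if u.1 = u.2 then 1 / 2 else 0) +
        (lowFlip n + cgA n) := by
  rw [BDTriple.rMat, cremmerGervais_aMat, rStd_eq, rZero, ← Matrix.diagonal_add]
  abel

theorem lowFlip_mul_lowFlip (n : ℕ) : lowFlip n * lowFlip n = 0 := by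
  ext u v
  rw [lowFlip_mul_apply]
  split_ifs with h
  · simp [lowFlip, h.le.not_gt]
  · rfl

theorem rMat_mul_rMat_apply {n : ℕ} (s : Matrix (Fin n) (Fin n) ℂ) (u v : Fin n × Fin n) :
    ((BDTriple.cremmerGervais n).rMat s * (BDTriple.cremmerGervais n).rMat s) u v =
      (if u = v then (s u.1 u.2 + if u.1 = u.2 then 1 / 2 else 0) ^ 2 else 0) +
        ((s u.1 u.2 + if u.1 = u.2 then 1 / 2 else 0) +
          (s v.1 v.2 + if v.1 = v.2 then 1 / 2 else 0)) * (lowFlip n u v + cgA n u v) +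
        ((if u.2 < u.1 then 1 else 0) - if v.1 < v.2 then 1 else 0) * cgA n u v := by
  rw [rMat_eq]
  simp only [Matrix.add_mul, Matrix.mul_add, lowFlip_mul_lowFlip, cgA_mul_cgA,
    Matrix.diagonal_mul_diagonal, Matrix.add_apply, Matrix.diagonal_mul, Matrix.mul_diagonal,
    cgA_mul_lowFlip_apply, lowFlip_mul_cgA_apply, Matrix.diagonal_apply, Matrix.zero_apply]
  by_cases h : u = v
  · subst h
    simp only [if_true]
    by_cases h1 : u.2 < u.1 <;> by_cases h2 : u.1 < u.2 <;> simp [h1, h2] <;> ring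
  · by_cases h1 : u.2 < u.1 <;> by_cases h2 : v.1 < v.2 <;> simp [h, h1, h2] <;> ring

theorem RGGS_apply {n : ℕ} (s : Matrix (Fin n) (Fin n) ℂ) (ħ : ℂ) (u v : Fin n × Fin n) :
    (BDTriple.cremmerGervais n).RGGS s ħ u v = qpow ħ (s u.1 u.2 + s v.1 v.2) *
      ((if u = v then qpow ħ (if u.1 = u.2 then 1 else 0) else 0) + qdiff ħ * (lowFlip n u v +
        (iverson (Inside u v) * qpow ħ (heightExp u - 1) -
          iverson (Inside u v.swap) * qpow ħ (heightExp u)))) := by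
  rw [BDTriple.RGGS, qpowRZero, Matrix.mul_diagonal, Matrix.diagonal_mul, Matrix.add_apply,
    Matrix.smul_apply, cremmerGervais_aTilde_apply, RStd_eq, Matrix.add_apply, Matrix.smul_apply,
    Matrix.diagonal_apply, smul_eq_mul, smul_eq_mul, qpow_add]
  have : (if u.1 = u.2 then Complex.exp ħ else 1) = qpow ħ (if u.1 = u.2 then 1 else 0) := by
    split_ifs
    · rw [qpow_one]
    · rw [qpow_zero]
  rw [this]
  ring

theorem not_inside_self {n : ℕ} (u : Fin n × Fin n) : ¬Inside u u := fun h => h.2.1.false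

theorem cgA_self {n : ℕ} (u : Fin n × Fin n) : cgA n u u = 0 := by
  rw [cgA_apply, iverson_false (not_inside_self u),
    iverson_false (by rw [← inside_swap_left]; exact not_inside_self _), sub_zero]

theorem cremmerGervais_isGGS {n : ℕ} {s : Matrix (Fin n) (Fin n) ℂ} (hs : sᵀ = -s) :
    (BDTriple.cremmerGervais n).IsGGS s ((BDTriple.cremmerGervais n).RGGS s) := by
  rw [isGGS_iff]
  intro u v
  rw [rMat_mul_rMat_apply, rMat_eq, Matrix.add_apply, Matrix.add_apply, Matrix.diagonal_apply]
  simp only [RGGS_apply]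
  have hs' : ∀ i j, s i j + s j i = 0 := fun i j => by
    have := congrFun (congrFun hs j) i
    rw [Matrix.transpose_apply, Matrix.neg_apply] at this
    rw [this, neg_add_cancel]
  have key0 : ∀ {f : ℂ → ℂ} {c₀ c₁ c₂ : ℂ} (x y : ℂ),
      (∀ ħ, f ħ = x * qpow ħ y * qdiff ħ ^ 0) → c₀ = x → c₁ = x * y → c₂ = x * y ^ 2 / 2 →
        IsForm f ∧ HasJet f c₀ c₁ c₂ := by
    intro f c₀ c₁ c₂ x y hf h0 h1 h2
    refine ⟨⟨x, y, 0, Or.inl rfl, hf⟩, ?_⟩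
    rw [funext hf, h0, h1, h2]
    exact hasJet_form_zero x y
  have key1 : ∀ {f : ℂ → ℂ} {c₀ c₁ c₂ : ℂ} (x y : ℂ),
      (∀ ħ, f ħ = x * qpow ħ y * qdiff ħ ^ 1) → c₀ = 0 → c₁ = 2 * x → c₂ = 2 * x * y →
        IsForm f ∧ HasJet f c₀ c₁ c₂ := by
    intro f c₀ c₁ c₂ x y hf h0 h1 h2
    refine ⟨⟨x, y, 1, Or.inr rfl, hf⟩, ?_⟩
    rw [funext hf, h0, h1, h2]
    exact hasJet_form_one x y
  by_cases h1 : u = v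
  · subst h1
    have hL : lowFlip n u u = 0 := by
      rw [lowFlip, Matrix.of_apply, if_neg]
      rintro ⟨h, h'⟩
      exact h'.ne (congrArg Prod.snd h)
    have hI : ¬Inside u u.swap := by rw [← inside_swap_left]; exact not_inside_self _
    rw [cgA_self, hL, iverson_false (not_inside_self u), iverson_false hI, if_pos rfl, if_pos rfl,
      Matrix.one_apply_eq]
    simp only [if_true]
    refine key0 1 (s u.1 u.2 + s u.1 u.2 + if u.1 = u.2 then 1 else 0) (fun ħ => ?_) rfl ?_ ?_
    · rw [qpow_add _ (_ + _)]
      ring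
    · split_ifs <;> ring
    · split_ifs <;> ring
  rw [Matrix.one_apply_ne h1]
  simp only [if_neg h1]
  by_cases h2 : v = u.swap ∧ u.2 < u.1
  · have hL : lowFlip n u v = 1 := if_pos h2
    obtain ⟨rfl, h3⟩ := h2
    have hI : ¬Inside u u.swap := by rw [← inside_swap_left]; exact not_inside_self _
    rw [hL, cgA_swap_right, cgA_self, Prod.swap_swap, iverson_false (not_inside_self u),
      iverson_false hI, if_neg h3.ne', Prod.fst_swap, Prod.snd_swap, if_neg h3.ne, hs']
    refine key1 1 0 (fun ħ => by ring) rfl (by ring) ?_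
    linear_combination 2 * hs' u.1 u.2
  have hL : lowFlip n u v = 0 := if_neg h2
  rw [hL, cgA_apply]
  by_cases h3 : Inside u v
  · rw [iverson_true h3, iverson_false h3.not_swap, if_neg h3.lt.ne, if_pos h3.lt]
    refine key1 1 (s u.1 u.2 + s v.1 v.2 + (heightExp u - 1)) (fun ħ => ?_) rfl (by ring) ?_
    · rw [qpow_add _ (_ + _)]
      ring
    · rw [heightExp_eq]
      ring
  by_cases h4 : Inside u v.swap
  · have h5 : v.2 < v.1 := h4.lt
    rw [iverson_true h4, iverson_false h3, if_neg h5.ne', if_neg h5.le.not_gt]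
    refine key1 (-1) (s u.1 u.2 + s v.1 v.2 + heightExp u) (fun ħ => ?_) rfl (by ring) ?_
    · rw [qpow_add _ (_ + _)]
      ring
    · rw [heightExp_eq]
      ring
  · rw [iverson_false h3, iverson_false h4]
    exact key0 0 0 (fun ħ => by ring) rfl (by ring) (by ring)

theorem inverse_cremmerGervais_rMat {n : ℕ} (s : Matrix (Fin n) (Fin n) ℂ) :
    (BDTriple.cremmerGervais n).inverse.rMat s =
      antiflip ((BDTriple.cremmerGervais n).rMat sᵀ) := by
  rw [BDTriple.rMat, BDTriple.rMat, antiflip_add, antiflip_add, antiflip_rStd,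
    inverse_cremmerGervais_aMat, cremmerGervais_aMat, rZero, rZero, antiflip_diagonal]
  rfl

theorem inverse_cremmerGervais_isGGS {n : ℕ} {s : Matrix (Fin n) (Fin n) ℂ} (hs : sᵀ = -s) :
    (BDTriple.cremmerGervais n).inverse.IsGGS s ((BDTriple.cremmerGervais n).inverse.RGGS s) := by
  have h := cremmerGervais_isGGS (s := sᵀ) (by rw [hs, transpose_neg, hs])
  rw [isGGS_iff] at h ⊢
  intro u v
  have h' := h v.swap u.swap
  simp only [inverse_cremmerGervais_RGGS, inverse_cremmerGervais_rMat, ← antiflip_mul]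
  rw [← antiflip_one]
  exact h'

theorem exists_rZero_eq {n : ℕ} {s : Matrix (Fin n) (Fin n) ℂ} (hs : sᵀ = -s)
    (h : ∀ a b c j : Fin n, b.val = a.val + 1 → c.val = a.val + 2 →
      s a j - 2 * s b j + s c j =
        1 / 2 * ((if j = a then 1 else 0) - if j = c then 1 else 0)) :
    ∃ t : ℂ, ∀ i j : Fin n, s i j =
      (if i < j then 1 / 2 else if j < i then -1 / 2 else 0) + t * ((j.val : ℂ) - i.val) := by
  have hs' : ∀ i j, s i j = -s j i := fun i j => by
    have := congrFun (congrFun hs j) i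
    rwa [Matrix.transpose_apply, Matrix.neg_apply] at this
  set f : Fin n → Fin n → ℂ :=
    fun i j => s i j - if i < j then 1 / 2 else if j < i then -1 / 2 else 0 with hf
  have fanti : ∀ i j, f i j = -f j i := by
    intro i j
    simp only [hf]
    rw [hs' i j]
    rcases lt_trichotomy i j with h1 | rfl | h1
    · simp [h1, h1.le.not_gt]
      ring
    · simp
    · simp [h1, h1.le.not_gt]
      ring
  have frec : ∀ a b c j : Fin n, b.val = a.val + 1 → c.val = a.val + 2 →
      f a j - 2 * f b j + f c j = 0 := by
    intro a b c j h1 h2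
    have h3 := h a b c j h1 h2
    simp only [hf, Fin.lt_def, Fin.ext_iff] at h3 ⊢
    rcases lt_trichotomy j.val b.val with h4 | h4 | h4
    · by_cases h5 : j.val = a.val
      · simp only [h5, h1, h2] at h3 ⊢
        norm_num at h3 ⊢
        linear_combination h3
      · have h6 : j.val < a.val := by omega
        rw [if_neg h5, if_neg (by omega)] at h3
        rw [if_neg h6.le.not_gt, if_pos h6, if_neg h4.le.not_gt, if_pos h4, if_neg (by omega),
          if_pos (by omega)]
        linear_combination h3
    · rw [if_neg (by omega), if_neg (by omega)] at h3
      rw [if_pos (by omega), if_neg (by omega), if_neg (by omega), if_neg (by omega),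
        if_pos (by omega)]
      linear_combination h3
    · by_cases h5 : j.val = c.val
      · simp only [h5, h1, h2] at h3 ⊢
        norm_num at h3 ⊢
        linear_combination h3
      · rw [if_neg (by omega), if_neg (by omega)] at h3
        rw [if_pos (by omega), if_pos (by omega), if_pos (by omega)]
        linear_combination h3
  suffices hsuff : ∃ t : ℂ, ∀ i j : Fin n, f i j = t * ((j.val : ℂ) - i.val) by
    obtain ⟨t, ht⟩ := hsuff
    refine ⟨t, fun i j => ?_⟩
    rw [← ht i j]
    simp only [hf]
    ring
  have f0 : ∀ i, f i i = 0 := fun i => self_eq_neg.1 (fanti i i)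
  rcases lt_or_ge n 2 with hn | hn
  · refine ⟨0, fun i j => ?_⟩
    have : i = j := Fin.ext (by omega)
    rw [this, f0, zero_mul]
  set z : Fin n := ⟨0, by omega⟩
  set o : Fin n := ⟨1, by omega⟩
  have lin : ∀ k j : Fin n, f k j = f z j + k.val * (f o j - f z j) := by
    intro k j
    have H : ∀ m : ℕ, (∀ hm : m < n, f ⟨m, hm⟩ j = f z j + m * (f o j - f z j)) ∧
        (∀ hm : m + 1 < n, f ⟨m + 1, hm⟩ j = f z j + ((m + 1 : ℕ) : ℂ) * (f o j - f z j)) := by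
      intro m
      induction m with
      | zero =>
        refine ⟨fun hm => ?_, fun hm => ?_⟩
        · simp [z]
        · simp [o]
      | succ m ih =>
        refine ⟨ih.2, fun hm => ?_⟩
        have h1 := frec ⟨m, by omega⟩ ⟨m + 1, by omega⟩ ⟨m + 2, by omega⟩ j rfl rfl
        have h2 := ih.1 (by omega)
        have h3 := ih.2 (by omega)
        push_cast at h2 h3 ⊢
        linear_combination h1 - h2 + 2 * h3
    exact (H k.val).1 k.isLt
  refine ⟨f z o, fun i j => ?_⟩
  have h1 : f z j = j.val * f z o := by
    rw [fanti z j, lin j z, f0, fanti o z]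
    ring
  have h2 : f o j = (j.val - 1) * f z o := by
    rw [fanti o j, lin j o, f0]
    ring
  rw [lin i j, h1, h2]
  ring

theorem vecMul_simpleRoot {n : ℕ} (k : Fin (n - 1)) (s : Matrix (Fin n) (Fin n) ℂ) (j : Fin n) :
    (simpleRoot k ᵥ* s) j = s (simplePair k).1 j - s (simplePair k).2 j := by
  rw [simpleRoot, rootVec, Matrix.sub_vecMul, Pi.sub_apply, Matrix.single_one_vecMul,
    Matrix.single_one_vecMul]
  rfl

theorem cremmerGervais_isR0 {n : ℕ} {s : Matrix (Fin n) (Fin n) ℂ}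
    (hs : (BDTriple.cremmerGervais n).IsR0 s) (a b c j : Fin n) (hb : b.val = a.val + 1)
    (hc : c.val = a.val + 2) :
    s a j - 2 * s b j + s c j =
      1 / 2 * ((if j = a then 1 else 0) - if j = c then 1 else 0) := by
  have h1 : a.val < n - 1 := by have := c.isLt; omega
  have h2 : (⟨a.val, h1⟩ : Fin (n - 1)) ∈ (BDTriple.cremmerGervais n).Γ₁ :=
    Finset.mem_filter.2 ⟨Finset.mem_univ _, by have := c.isLt; dsimp only; omega⟩
  have h3 := congrFun (hs.2 ⟨_, h2⟩) j
  rw [Matrix.sub_vecMul, Pi.sub_apply, vecMul_simpleRoot, vecMul_simpleRoot, Pi.smul_apply,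
    Pi.add_apply, simpleRoot, simpleRoot, rootVec_apply, rootVec_apply, smul_eq_mul] at h3
  have h4 : a.val + 1 < n := hb ▸ b.isLt
  have h5 : a.val + 1 + 1 < n := hc ▸ c.isLt
  obtain rfl : b = ⟨a.val + 1, h4⟩ := Fin.ext hb
  obtain rfl : c = ⟨a.val + 1 + 1, h5⟩ := Fin.ext hc
  simp only [Fin.ext_iff]
  change s a j - s ⟨a.val + 1, h4⟩ j - (s ⟨a.val + 1, h4⟩ j - s ⟨a.val + 1 + 1, h5⟩ j) =
    1 / 2 * (((if j.val = a.val then 1 else 0) - if j.val = a.val + 1 then 1 else 0) +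
      ((if j.val = a.val + 1 then 1 else 0) - if j.val = a.val + 1 + 1 then 1 else 0)) at h3
  linear_combination h3

theorem inverse_cremmerGervais_isR0 {n : ℕ} {s : Matrix (Fin n) (Fin n) ℂ}
    (hs : (BDTriple.cremmerGervais n).inverse.IsR0 s) :
    (BDTriple.cremmerGervais n).IsR0 sᵀ := by
  refine ⟨by rw [hs.1, transpose_neg, hs.1], fun k => ?_⟩
  have h := hs.2 ((BDTriple.cremmerGervais n).τ k)
  have e : (BDTriple.cremmerGervais n).inverse.τ ((BDTriple.cremmerGervais n).τ k) = k :=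
    (BDTriple.cremmerGervais n).τ.symm_apply_apply k
  rw [e] at h
  rw [hs.1, Matrix.vecMul_neg, ← Matrix.neg_vecMul, neg_sub, h, add_comm]

/-- The row vector of the monomials `a^x b^y`. -/
def monRow₂ (n : ℕ) (a b : ℂ) : Fin n × Fin n → ℂ := fun u => a ^ u.1.val * b ^ u.2.val

/-- The row vector of the monomials `a^x b^y c^z`. -/
def monRow₃ (n : ℕ) (a b c : ℂ) : Fin n × Fin n × Fin n → ℂ :=
  fun u => a ^ u.1.val * b ^ u.2.1.val * c ^ u.2.2.val

section Density

variable {n : ℕ}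

theorem eq_zero_of_sum_pow_eq_zero (c : Fin n → ℂ) (F : Set ℂ) (hF : F.Finite)
    (h : ∀ a ∉ F, ∑ i, a ^ i.val * c i = 0) (i : Fin n) : c i = 0 := by
  set p : Polynomial ℂ := ∑ i : Fin n, Polynomial.monomial i.val (c i) with hp
  have hp0 : p = 0 := by
    refine Polynomial.eq_zero_of_infinite_isRoot p (hF.infinite_compl.mono fun a ha => ?_)
    have h1 := h a ha
    simp only [Set.mem_ofPred_eq, Polynomial.IsRoot, hp, Polynomial.eval_finsetSum,
      Polynomial.eval_monomial]
    rw [← h1]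
    exact Finset.sum_congr rfl fun i _ => mul_comm _ _
  have h2 : p.coeff i.val = c i := by
    simp only [hp, Polynomial.finsetSum_coeff, Polynomial.coeff_monomial]
    rw [Finset.sum_eq_single i]
    · simp
    · intro b _ hb
      rw [if_neg fun h => hb (Fin.ext h)]
    · simp
  rw [← h2, hp0, Polynomial.coeff_zero]

theorem eq_zero_of_monRow₃_vecMul (t : ℂ)
    (X : Matrix (Fin n × Fin n × Fin n) (Fin n × Fin n × Fin n) ℂ)
    (h : ∀ a b c : ℂ, a ≠ t * b → a ≠ t * (t * c) → b ≠ t * c → monRow₃ n a b c ᵥ* X = 0) :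
    X = 0 := by
  ext ⟨x, y, z⟩ w
  have h3 : ∀ c, ∀ b ∉ ({t * c} : Set ℂ), ∀ x : Fin n,
      ∑ y : Fin n, b ^ y.val * ∑ z : Fin n, c ^ z.val * X (x, y, z) w = 0 := by
    intro c b hb x
    refine eq_zero_of_sum_pow_eq_zero
      (fun x => ∑ y : Fin n, b ^ y.val * ∑ z : Fin n, c ^ z.val * X (x, y, z) w)
      {t * b, t * (t * c)} (Set.toFinite _) (fun a ha => ?_) x
    simp only [Set.mem_insert_iff, Set.mem_singleton_iff, not_or] at ha hb
    rw [← Pi.zero_apply (M := fun _ => ℂ) w, ← h a b c ha.1 ha.2 hb, Matrix.vecMul, dotProduct,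
      Fintype.sum_prod_type]
    refine Finset.sum_congr rfl fun x _ => ?_
    rw [Fintype.sum_prod_type, Finset.mul_sum]
    refine Finset.sum_congr rfl fun y _ => ?_
    rw [Finset.mul_sum, Finset.mul_sum]
    refine Finset.sum_congr rfl fun z _ => ?_
    rw [monRow₃]
    ring
  refine eq_zero_of_sum_pow_eq_zero (fun z => X (x, y, z) w) ∅ Set.finite_empty
    (fun c _ => ?_) z
  exact eq_zero_of_sum_pow_eq_zero (fun y => ∑ z : Fin n, c ^ z.val * X (x, y, z) w) {t * c}
    (Set.finite_singleton _) (fun b hb => h3 c b hb x) y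

end Density

section YangBaxter

variable {n : ℕ}

theorem monRow₃_vecMul_R12 (R : Mat2 n) (a b c : ℂ) (w : Fin n × Fin n × Fin n) :
    (monRow₃ n a b c ᵥ* R12 R) w = (monRow₂ n a b ᵥ* R) (w.1, w.2.1) * c ^ w.2.2.val := by
  simp only [Matrix.vecMul, dotProduct, Fintype.sum_prod_type, monRow₃, monRow₂, R12,
    Matrix.of_apply, mul_ite, mul_zero, Finset.sum_ite_eq', Finset.mem_univ, if_true,
    Finset.sum_mul]
  exact Finset.sum_congr rfl fun _ _ => Finset.sum_congr rfl fun _ _ => by ring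

theorem monRow₃_vecMul_R13 (R : Mat2 n) (a b c : ℂ) (w : Fin n × Fin n × Fin n) :
    (monRow₃ n a b c ᵥ* R13 R) w = (monRow₂ n a c ᵥ* R) (w.1, w.2.2) * b ^ w.2.1.val := by
  simp only [Matrix.vecMul, dotProduct, Fintype.sum_prod_type, monRow₃, monRow₂, R13,
    Matrix.of_apply, mul_ite, mul_zero, Finset.sum_mul]
  refine Finset.sum_congr rfl fun _ _ => ?_
  rw [Finset.sum_comm]
  refine Finset.sum_congr rfl fun _ _ => ?_
  rw [Finset.sum_ite_eq', if_pos (Finset.mem_univ _)]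
  ring

theorem monRow₃_vecMul_R23 (R : Mat2 n) (a b c : ℂ) (w : Fin n × Fin n × Fin n) :
    (monRow₃ n a b c ᵥ* R23 R) w = a ^ w.1.val * (monRow₂ n b c ᵥ* R) (w.2.1, w.2.2) := by
  simp only [Matrix.vecMul, dotProduct, Fintype.sum_prod_type, monRow₃, monRow₂, R23,
    Matrix.of_apply, mul_ite, mul_zero, Finset.mul_sum]
  rw [Finset.sum_eq_single w.1]
  · simp only [if_true]
    exact Finset.sum_congr rfl fun _ _ => Finset.sum_congr rfl fun _ _ => by ring
  · intro b _ hb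
    simp [hb]
  · simp

/-- The coefficient of the exchanged variables in a Demazure-Lusztig operator. -/
def exchCoeff (q t a b : ℂ) : ℂ := (q - q⁻¹) * a / (a - t * b)

theorem qybe_of_exchange (R : Mat2 n) {q t : ℂ} (hq : q ≠ 0) (ht : t ≠ 0)
    (h : ∀ a b, a ≠ t * b → monRow₂ n a b ᵥ* R =
      (q - exchCoeff q t a b) • monRow₂ n (a / t) (b * t) +
        exchCoeff q t a b • monRow₂ n b a) : QYBE R := by
  have h12 : ∀ a b c, a ≠ t * b → monRow₃ n a b c ᵥ* R12 R =
      (q - exchCoeff q t a b) • monRow₃ n (a / t) (b * t) c +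
        exchCoeff q t a b • monRow₃ n b a c := by
    intro a b c hab
    ext w
    rw [monRow₃_vecMul_R12, h a b hab]
    simp only [Pi.add_apply, Pi.smul_apply, smul_eq_mul, monRow₂, monRow₃]
    ring
  have h13 : ∀ a b c, a ≠ t * c → monRow₃ n a b c ᵥ* R13 R =
      (q - exchCoeff q t a c) • monRow₃ n (a / t) b (c * t) +
        exchCoeff q t a c • monRow₃ n c b a := by
    intro a b c hab
    ext w
    rw [monRow₃_vecMul_R13, h a c hab]
    simp only [Pi.add_apply, Pi.smul_apply, smul_eq_mul, monRow₂, monRow₃]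
    ring
  have h23 : ∀ a b c, b ≠ t * c → monRow₃ n a b c ᵥ* R23 R =
      (q - exchCoeff q t b c) • monRow₃ n a (b / t) (c * t) +
        exchCoeff q t b c • monRow₃ n a c b := by
    intro a b c hab
    ext w
    rw [monRow₃_vecMul_R23, h b c hab]
    simp only [Pi.add_apply, Pi.smul_apply, smul_eq_mul, monRow₂, monRow₃]
    ring
  rw [QYBE, ← sub_eq_zero]
  refine eq_zero_of_monRow₃_vecMul t _ fun a b c hab hac hbc => ?_
  have d1 : a - t * b ≠ 0 := sub_ne_zero.2 hab
  have d2 : a - t * (t * c) ≠ 0 := sub_ne_zero.2 hac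
  have d3 : b - t * c ≠ 0 := sub_ne_zero.2 hbc
  have g1 : exchCoeff q t (a / t) c = exchCoeff q t a (c * t) := by
    have : a / t - t * c ≠ 0 := by
      intro h0
      apply d2
      field_simp at h0
      linear_combination h0
    have d2' : a - t * (c * t) ≠ 0 := by rwa [mul_comm c t]
    rw [exchCoeff, exchCoeff, div_eq_div_iff this d2']
    field_simp
  have g2 : exchCoeff q t (b * t) (c * t) = exchCoeff q t b c := by
    rw [exchCoeff, exchCoeff, show b * t - t * (c * t) = (b - t * c) * t by ring, ← mul_assoc,
      mul_div_mul_right _ _ ht]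
  have g3 : exchCoeff q t (a / t) (b / t) = exchCoeff q t a b := by
    rw [exchCoeff, exchCoeff, show a / t - t * (b / t) = (a - t * b) / t by field_simp,
      ← mul_div_assoc, div_div_div_cancel_right₀ ht]
  have n1 : a / t ≠ t * c := fun h0 => hac (by field_simp at h0; linear_combination h0)
  have n2 : b * t ≠ t * (c * t) := fun h0 => hbc (mul_right_cancel₀ ht (by rw [h0]; ring))
  have n3 : b * t ≠ t * (a / t) := fun h0 => hab (by field_simp at h0; linear_combination -h0)
  have n4 : a ≠ t * (c * t) := by rwa [mul_comm c t]
  have n5 : a / t ≠ t * (b / t) := fun h0 => hab (by field_simp at h0; linear_combination h0)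
  have n6 : c * t ≠ t * (b / t) := fun h0 => hbc (by field_simp at h0; linear_combination -h0)
  rw [Matrix.vecMul_sub, ← Matrix.vecMul_vecMul, ← Matrix.vecMul_vecMul, ← Matrix.vecMul_vecMul,
    ← Matrix.vecMul_vecMul, h12 a b c hab, h23 a b c hbc]
  simp only [Matrix.add_vecMul, Matrix.smul_vecMul]
  rw [h13 _ _ _ n1, h13 _ _ _ hbc, h13 _ _ _ n4, h13 _ _ _ hab]
  simp only [Matrix.add_vecMul, Matrix.smul_vecMul]
  rw [h23 _ _ _ n2, h23 _ _ _ n3, h23 _ _ _ n4, h23 _ _ _ hab, h12 _ _ _ n5, h12 _ _ _ n6,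
    h12 _ _ _ n1, h12 _ _ _ hbc]
  simp only [mul_div_cancel_right₀ _ ht, div_mul_cancel₀ _ ht, g1, g2, g3]
  have d6 : a - t * (c * t) ≠ 0 := sub_ne_zero.2 n4
  have r1 : exchCoeff q t (b * t) (a / t) = q - q⁻¹ - exchCoeff q t a b := by
    rw [exchCoeff, exchCoeff, mul_div_cancel₀ _ ht,
      show b * t - a = -(a - t * b) by ring, div_neg, ← neg_div,
      eq_sub_iff_add_eq, ← add_div, div_eq_iff d1]
    ring
  have r2 : exchCoeff q t (c * t) (b / t) = q - q⁻¹ - exchCoeff q t b c := by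
    rw [exchCoeff, exchCoeff, mul_div_cancel₀ _ ht,
      show c * t - b = -(b - t * c) by ring, div_neg, ← neg_div,
      eq_sub_iff_add_eq, ← add_div, div_eq_iff d3]
    ring
  have r3 : exchCoeff q t a (c * t) * (q - q⁻¹) =
      exchCoeff q t a b * exchCoeff q t a (c * t) + exchCoeff q t a (c * t) * exchCoeff q t b c -
        exchCoeff q t a b * exchCoeff q t b c := by
    simp only [exchCoeff]
    generalize q - q⁻¹ = l
    have d7 : a - t ^ 2 * c ≠ 0 := by rwa [show t ^ 2 * c = t * (c * t) by ring]
    rw [show t * (c * t) = t ^ 2 * c by ring]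
    field_simp
    ring
  rw [r1, r2]
  generalize exchCoeff q t a b = x at *
  generalize exchCoeff q t a (c * t) = y at *
  generalize exchCoeff q t b c = z at *
  generalize q⁻¹ = p at *
  ext w
  simp only [Pi.add_apply, Pi.sub_apply, Pi.smul_apply, smul_eq_mul, Pi.zero_apply]
  linear_combination (q - x) * monRow₃ n c (a / t) (b * t) w * r3 -
    (q - z) * monRow₃ n (b / t) (c * t) a w * r3 + (x - z) * monRow₃ n c b a w * r3

end YangBaxter

section Reversal

variable {n : ℕ}

/-- The permutation `(x, y, z) ↦ (z, y, x)`. -/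
def tripleRev (n : ℕ) : Fin n × Fin n × Fin n ≃ Fin n × Fin n × Fin n where
  toFun u := (u.2.2, u.2.1, u.1)
  invFun u := (u.2.2, u.2.1, u.1)
  left_inv _ := rfl
  right_inv _ := rfl

theorem R12_antiflip (R : Mat2 n) :
    R12 (antiflip R) = ((R23 R).submatrix (tripleRev n) (tripleRev n))ᵀ := by
  ext u v
  simp only [R12, R23, Matrix.of_apply, Matrix.transpose_apply, Matrix.submatrix_apply,
    antiflip_apply, tripleRev, Equiv.coe_fn_mk, Prod.swap, eq_comm]

theorem R13_antiflip (R : Mat2 n) :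
    R13 (antiflip R) = ((R13 R).submatrix (tripleRev n) (tripleRev n))ᵀ := by
  ext u v
  simp only [R13, Matrix.of_apply, Matrix.transpose_apply, Matrix.submatrix_apply,
    antiflip_apply, tripleRev, Equiv.coe_fn_mk, Prod.swap, eq_comm]

theorem R23_antiflip (R : Mat2 n) :
    R23 (antiflip R) = ((R12 R).submatrix (tripleRev n) (tripleRev n))ᵀ := by
  ext u v
  simp only [R12, R23, Matrix.of_apply, Matrix.transpose_apply, Matrix.submatrix_apply,
    antiflip_apply, tripleRev, Equiv.coe_fn_mk, Prod.swap, eq_comm]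

theorem QYBE.antiflip {R : Mat2 n} (h : QYBE R) : QYBE (antiflip R) := by
  rw [QYBE] at h ⊢
  rw [R12_antiflip, R13_antiflip, R23_antiflip]
  simp only [← Matrix.transpose_mul, Matrix.submatrix_mul_equiv]
  rw [← Matrix.mul_assoc, ← Matrix.mul_assoc, h]

end Reversal

section Exchange

variable {n : ℕ}

theorem sub_mul_sum_Ico (a b : ℂ) {i j S : ℕ} (hij : i ≤ j) (hj : j ≤ S + 1) :
    (a - b) * ∑ k ∈ Finset.Ico i j, a ^ k * b ^ (S - k) =
      a ^ j * b ^ (S + 1 - j) - a ^ i * b ^ (S + 1 - i) := by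
  induction j, hij using Nat.le_induction with
  | base => simp
  | succ j hij ih =>
    rw [Finset.sum_Ico_succ_top hij, mul_add, ih (by omega),
      show S + 1 - j = S - j + 1 by omega, show S + 1 - (j + 1) = S - j by omega]
    ring

theorem sum_inside_monRow₂ (a b : ℂ) {v : Fin n × Fin n} (hv : v.1 < v.2) :
    (a - b) * ∑ u, monRow₂ n a b u * iverson (Inside u v) =
      a ^ v.2.val * b ^ (v.1.val + 1) - a ^ (v.1.val + 1) * b ^ v.2.val := by
  have hv' := Fin.lt_def.1 hv
  have h1 : ∑ u, monRow₂ n a b u * iverson (Inside u v) =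
      ∑ k ∈ Finset.Ico (v.1.val + 1) v.2.val, a ^ k * b ^ (v.1.val + v.2.val - k) := by
    classical
    simp only [iverson, mul_ite, mul_one, mul_zero]
    rw [← Finset.sum_filter]
    refine Finset.sum_bij (fun u _ => u.1.val) ?_ ?_ ?_ ?_
    · intro u hu
      have := (Finset.mem_filter.1 hu).2
      simp only [Inside, Fin.lt_def] at this
      rw [Finset.mem_Ico]
      omega
    · intro u hu w hw huw
      have h1 := (Finset.mem_filter.1 hu).2.1
      have h2 := (Finset.mem_filter.1 hw).2.1
      exact Prod.ext (Fin.ext huw) (Fin.ext (by omega))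
    · intro k hk
      rw [Finset.mem_Ico] at hk
      have := v.2.isLt
      refine ⟨(⟨k, by omega⟩, ⟨v.1.val + v.2.val - k, by omega⟩), Finset.mem_filter.2
        ⟨Finset.mem_univ _, ?_⟩, rfl⟩
      simp only [Inside, Fin.lt_def]
      omega
    · intro u hu
      have := (Finset.mem_filter.1 hu).2.1
      rw [monRow₂, show v.1.val + v.2.val - u.1.val = u.2.val by omega]
  rw [h1, sub_mul_sum_Ico a b (by omega) (by omega),
    show v.1.val + v.2.val + 1 - v.2.val = v.1.val + 1 by omega,
    show v.1.val + v.2.val + 1 - (v.1.val + 1) = v.2.val by omega]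

theorem monRow₂_vecMul_cgA (a b : ℂ) {v : Fin n × Fin n} (hv : v.1 < v.2) :
    (a - b) * (monRow₂ n a b ᵥ* cgA n) v =
      a ^ v.2.val * b ^ (v.1.val + 1) - a ^ (v.1.val + 1) * b ^ v.2.val := by
  rw [← sum_inside_monRow₂ a b hv, Matrix.vecMul, dotProduct]
  congr 1
  refine Finset.sum_congr rfl fun u _ => ?_
  rw [cgA_apply, iverson_false (p := Inside u v.swap) fun h => (h.lt.trans hv).false, sub_zero]

theorem monRow₂_vecMul_cgA_swap (a b : ℂ) (v : Fin n × Fin n) :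
    (monRow₂ n a b ᵥ* cgA n) v.swap = -(monRow₂ n a b ᵥ* cgA n) v := by
  simp only [Matrix.vecMul, dotProduct, cgA_swap_right, mul_neg, Finset.sum_neg_distrib]

theorem monRow₂_vecMul_lowFlip (a b : ℂ) (v : Fin n × Fin n) :
    (monRow₂ n a b ᵥ* lowFlip n) v = if v.1 < v.2 then monRow₂ n b a v else 0 := by
  rw [Matrix.vecMul, dotProduct, Finset.sum_eq_single v.swap]
  · simp [lowFlip, monRow₂, mul_comm]
  · intro p _ hp
    have : v ≠ p.swap := fun h => hp (by rw [h, Prod.swap_swap])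
    simp [lowFlip, this]
  · simp

/-- The Cremmer-Gervais matrix with `s_{ij} = ½ sgn(j - i)`. -/
def cgR (n : ℕ) (q : ℂ) : Mat2 n :=
  Matrix.diagonal (fun u : Fin n × Fin n => if u.2 < u.1 then q⁻¹ else q) +
    (q - q⁻¹) • (lowFlip n + cgA n)

theorem monRow₂_vecMul_cgR (q : ℂ) {a b : ℂ} (hab : a ≠ b) :
    monRow₂ n a b ᵥ* cgR n q =
      (q - exchCoeff q 1 a b) • monRow₂ n a b + exchCoeff q 1 a b • monRow₂ n b a := by
  ext v
  have d : a - b ≠ 0 := sub_ne_zero.2 hab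
  simp only [cgR, Matrix.vecMul_add, Matrix.vecMul_smul, Pi.add_apply, Pi.smul_apply,
    Matrix.vecMul_diagonal, monRow₂_vecMul_lowFlip, smul_eq_mul, exchCoeff, one_mul]
  rcases lt_trichotomy v.1 v.2 with h | h | h
  · have h1 := monRow₂_vecMul_cgA a b h
    rw [mul_comm, ← eq_div_iff d] at h1
    rw [if_neg h.le.not_gt, if_pos h, h1]
    simp only [monRow₂]
    generalize q - q⁻¹ = l
    field_simp
    ring
  · have h1 : (monRow₂ n a b ᵥ* cgA n) v = 0 := by
      rw [Matrix.vecMul, dotProduct]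
      exact Finset.sum_eq_zero fun u _ => by rw [cgA_diag u v h, mul_zero]
    rw [if_neg h.not_gt, if_neg h.not_lt, h1]
    simp only [monRow₂, h]
    ring
  · have h1 := monRow₂_vecMul_cgA a b (v := v.swap) h
    rw [monRow₂_vecMul_cgA_swap, mul_comm, ← eq_div_iff d, neg_eq_iff_eq_neg] at h1
    rw [if_pos h, if_neg h.le.not_gt, h1]
    simp only [monRow₂, Prod.fst_swap, Prod.snd_swap]
    generalize q⁻¹ = p
    field_simp
    ring

theorem cremmerGervais_RGGS_eq {s : Matrix (Fin n) (Fin n) ℂ} {t : ℂ}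
    (hs : ∀ i j : Fin n, s i j =
      (if i < j then 1 / 2 else if j < i then -1 / 2 else 0) + t * ((j.val : ℂ) - i.val))
    (ħ : ℂ) :
    (BDTriple.cremmerGervais n).RGGS s ħ =
      Matrix.diagonal (fun u : Fin n × Fin n => qpow ħ t ^ u.2.val / qpow ħ t ^ u.1.val) *
        cgR n (qpow ħ 1) *
      Matrix.diagonal (fun u : Fin n × Fin n => qpow ħ t ^ u.2.val / qpow ħ t ^ u.1.val) := by
  have hd : ∀ u : Fin n × Fin n, qpow ħ (t * ((u.2.val : ℂ) - u.1.val)) =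
      qpow ħ t ^ u.2.val / qpow ħ t ^ u.1.val := by
    intro u
    simp only [qpow, ← Complex.exp_nat_mul]
    rw [← Complex.exp_sub]
    congr 1
    ring
  have hinv : (qpow ħ 1)⁻¹ = qpow ħ (-1) :=
    inv_eq_of_mul_eq_one_right (qpow_one_mul_neg_one ħ)
  ext u v
  rw [RGGS_apply, Matrix.mul_diagonal, Matrix.diagonal_mul, cgR, hinv, Matrix.add_apply,
    Matrix.smul_apply, Matrix.add_apply, smul_eq_mul, ← qdiff_eq, Matrix.diagonal_apply,
    ← hd, ← hd, hs, hs]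
  have hsplit : ∀ x y x' y' z : ℂ, qpow ħ (x + y + (x' + y')) * z =
      qpow ħ y * (qpow ħ (x + x') * z) * qpow ħ y' := by
    intro x y x' y' z
    rw [show x + y + (x' + y') = y + (x + x') + y' by ring, qpow_add, qpow_add]
    ring
  rw [hsplit]
  congr 2
  have key : ∀ w x y : ℂ, y + x = w → qpow ħ y * qpow ħ x = qpow ħ w := by
    rintro w x y rfl
    rw [qpow_add]
  by_cases h1 : u = v
  · subst h1
    have hL : lowFlip n u u = 0 := by
      rw [lowFlip, Matrix.of_apply, if_neg]
      rintro ⟨h, h'⟩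
      exact h'.ne (congrArg Prod.snd h)
    have hI : ¬Inside u u.swap := by rw [← inside_swap_left]; exact not_inside_self _
    rw [cgA_self, hL, iverson_false (not_inside_self u), iverson_false hI, if_pos rfl, if_pos rfl]
    simp only [zero_mul, sub_zero, add_zero, mul_zero]
    rcases lt_trichotomy u.1 u.2 with h | h | h
    · rw [if_pos h, if_neg h.ne, if_neg h.le.not_gt]
      exact key _ _ _ (by ring)
    · rw [if_neg h.not_lt, if_neg h.not_gt, if_pos h, if_neg h.not_gt]
      exact key _ _ _ (by ring)
    · rw [if_neg h.le.not_gt, if_pos h, if_neg h.ne', if_pos h]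
      exact key _ _ _ (by ring)
  rw [if_neg h1, if_neg h1, zero_add, zero_add]
  by_cases h2 : v = u.swap ∧ u.2 < u.1
  · have hL : lowFlip n u v = 1 := if_pos h2
    obtain ⟨rfl, h3⟩ := h2
    have hI : ¬Inside u u.swap := by rw [← inside_swap_left]; exact not_inside_self _
    rw [hL, cgA_swap_right, cgA_self, Prod.swap_swap, iverson_false (not_inside_self u),
      iverson_false hI, Prod.fst_swap, Prod.snd_swap, if_neg h3.le.not_gt, if_pos h3, if_pos h3,
      show (-1 / 2 + 1 / 2 : ℂ) = 0 by norm_num, qpow_zero]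
    ring
  have hL : lowFlip n u v = 0 := if_neg h2
  rw [hL, cgA_apply]
  by_cases h3 : Inside u v
  · rw [iverson_true h3, iverson_false h3.not_swap, if_pos h3.lt]
    have : qpow ħ ((if u.1 < u.2 then 1 / 2 else if u.2 < u.1 then -1 / 2 else 0) + 1 / 2) *
        qpow ħ (heightExp u - 1) = qpow ħ 0 := by
      apply key
      rw [heightExp_eq]
      rcases lt_trichotomy u.1 u.2 with h | h | h
      · rw [if_pos h, if_neg h.ne, if_neg h.le.not_gt]
        ring
      · rw [if_neg h.not_lt, if_neg h.not_gt, if_pos h, if_neg h.not_gt]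
        ring
      · rw [if_neg h.le.not_gt, if_pos h, if_neg h.ne', if_pos h]
        ring
    rw [qpow_zero] at this
    linear_combination qdiff ħ * this
  by_cases h4 : Inside u v.swap
  · have h5 : v.2 < v.1 := h4.lt
    rw [iverson_true h4, iverson_false h3, if_neg h5.le.not_gt, if_pos h5]
    have : qpow ħ ((if u.1 < u.2 then 1 / 2 else if u.2 < u.1 then -1 / 2 else 0) + -1 / 2) *
        qpow ħ (heightExp u) = qpow ħ 0 := by
      apply key
      rw [heightExp_eq]
      rcases lt_trichotomy u.1 u.2 with h | h | h
      · rw [if_pos h, if_neg h.ne, if_neg h.le.not_gt]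
        ring
      · rw [if_neg h.not_lt, if_neg h.not_gt, if_pos h, if_neg h.not_gt]
        ring
      · rw [if_neg h.le.not_gt, if_pos h, if_neg h.ne', if_pos h]
        ring
    rw [qpow_zero] at this
    linear_combination -qdiff ħ * this
  · rw [iverson_false h3, iverson_false h4]
    ring

theorem cremmerGervais_qybe {s : Matrix (Fin n) (Fin n) ℂ}
    (hs : (BDTriple.cremmerGervais n).IsR0 s) (ħ : ℂ) :
    QYBE ((BDTriple.cremmerGervais n).RGGS s ħ) := by
  obtain ⟨t, ht⟩ := exists_rZero_eq hs.1 (cremmerGervais_isR0 hs)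
  have hp : qpow ħ t ≠ 0 := qpow_ne_zero ħ t
  have hq : qpow ħ 1 ≠ 0 := qpow_ne_zero ħ 1
  refine qybe_of_exchange _ hq (pow_ne_zero 2 hp) fun a b hab => ?_
  rw [cremmerGervais_RGGS_eq ht]
  generalize qpow ħ t = p at *
  generalize qpow ħ 1 = q at *
  have hab' : a / p ≠ b * p := by
    intro h
    apply hab
    field_simp at h
    linear_combination h
  have h1 : monRow₂ n a b ᵥ* Matrix.diagonal
      (fun u : Fin n × Fin n => p ^ u.2.val / p ^ u.1.val) = monRow₂ n (a / p) (b * p) := by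
    ext u
    rw [Matrix.vecMul_diagonal, monRow₂, monRow₂, div_pow, mul_pow]
    ring
  have hx : exchCoeff q 1 (a / p) (b * p) = exchCoeff q (p ^ 2) a b := by
    rw [exchCoeff, exchCoeff,
      show a / p - 1 * (b * p) = (a - p ^ 2 * b) / p by field_simp, ← mul_div_assoc,
      div_div_div_cancel_right₀ hp]
  rw [← Matrix.vecMul_vecMul, ← Matrix.vecMul_vecMul, h1, monRow₂_vecMul_cgR q hab', hx]
  ext u
  simp only [Matrix.vecMul_diagonal, Pi.add_apply, Pi.smul_apply, smul_eq_mul, monRow₂, div_pow,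
    mul_pow]
  field_simp
  ring

end Exchange

end GGS

end

theorem mainTheorem2 (n : ℕ) (T : GGS.BDTriple n)
    (hT : T = GGS.BDTriple.cremmerGervais n ∨ T = (GGS.BDTriple.cremmerGervais n).inverse)
    (s : Matrix (Fin n) (Fin n) ℂ) (hs : T.IsR0 s) :
    (∀ R : ℂ → GGS.Mat2 n, T.IsGGS s R ↔ R = T.RGGS s) ∧
      (∀ ħ : ℂ, T.RJ s ħ = T.RGGS s ħ) ∧
      (∀ ħ : ℂ, GGS.QYBE (T.RJ s ħ)) := by
  rcases hT with rfl | rfl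
  · refine ⟨GGS.isGGS_iff_eq (GGS.cremmerGervais_isGGS hs.1), GGS.cremmerGervais_RJ s,
      fun ħ => ?_⟩
    rw [GGS.cremmerGervais_RJ]
    exact GGS.cremmerGervais_qybe hs ħ
  · refine ⟨GGS.isGGS_iff_eq (GGS.inverse_cremmerGervais_isGGS hs.1),
      GGS.inverse_cremmerGervais_RJ s, fun ħ => ?_⟩
    rw [GGS.inverse_cremmerGervais_RJ, GGS.inverse_cremmerGervais_RGGS]
    exact (GGS.cremmerGervais_qybe (GGS.inverse_cremmerGervais_isR0 hs) ħ).antiflip
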